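/- Let $\mathcal U\subset\mathbb R^N$ be open, and let $f:\mathcal U\to\mathbb R^N$ and $B:\mathcal U\to\mathbb R^{N\times N}$ be smooth. Assume strict hyperbolicity: for every $u\in\mathcal U$ the matrix $\nabla f(u)$ has real eigenvalues $\lambda_1(u)<\dots<\lambda_N(u)$, with eigenvectors $r_1(u),\dots,r_N(u)$. For an open set $\mathcal V\subset\mathcal U$ and $u_B\in\mathcal V$ let $\mathcal E_{\mathcal V}(u_B)$ be the set of all $v_\infty\in\mathcal V$ for which the problem $$B(v)\,\partial_y v=f(v)-f(v_\infty),\qquad v(0)=u_B,\qquad \lim_{y\to\infty}v(y)=v_\infty$$ has a smooth solution $v:[0,\infty)\to\mathcal V$; the viscous boundary-layer set is $\mathcal E^{\text{layer}}_{\text{viscosity}}(u_B)=\mathcal E_{\mathcal U}(u_B)$. A $B$-convex entropy pair on $\mathcal U$ is a pair of $C^2$ functions $U,F:\mathcal U\to\mathbb R$ with $\nabla F^T=\nabla U^T\nabla f$ and $h^T\nabla^2U(u)B(u)h>0$ for all $u\in\mathcal U$ and $h\ne0$. Let $u_B\in\mathcal U$ and $0\le p\le N$, and assume that for all $u$ in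 a neighbourhood of $u_B$ every $r_j(u)$ is an eigenvector of $B(u)$ with a positive eigenvalue, $\lambda_j(u)<0$ for $j\le p$, and $\lambda_j(u)\ge0$ for $j>p$ (for $1\le p<N$ this is $\lambda_p(u)<0\le\lambda_{p+1}(u)$). Then: 1. $u_B\in\mathcal E^{\text{layer}}_{\text{viscosity}}(u_B)$, and $\mathcal E^{\text{layer}}_{\text{viscosity}}(u_B)$ contains a $p$-dimensional embedded $C^1$ submanifold of $\mathbb R^N$ passing through $u_B$. 2. Suppose moreover that $\lambda_j(u_B)>0$ for all $j>p$ (that is, $\lambda_{p+1}(u_B)>0$ if $p<N$). (a) If there is a $B$-convex entropy pair on $\mathcal U$, then $u_B$ has an open neighbourhood $W$ such that $\mathcal E^{\text{layer}}_{\text{viscosity}}(u_B)\cap W$ is an embedded $C^1$ submanifold of dimension exactly $p$ whose tangent space at $u_B$ is spanned by $r_1(u_B),\dots,r_p(u_B)$. (b) Without any assumption on entropies, $u_B$ has an open neighbourhood $\mathcal U_0\subset\mathcal U$ such that for every open $\mathcal V\subset\mathcal U_0$ containing $u_B$ the conclusion of (a) holds for $\mathcal E_{\mathcal V}(u_B)$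 in place of $\mathcal E^{\text{layer}}_{\text{viscosity}}(u_B)$, with some $W$ depending on $\mathcal V$. -/

import Mathlib

open Set Filter Topology
open scoped ContDiff

/-- The layer set of the state domain `𝒰`, the flux `f`, the viscosity matrix `B` and the boundary
state `uB`: all `w ∈ 𝒰` for which `B(v) v' = f(v) - f(w)`, `v(0) = uB`, `v(y) → w` as `y → ∞`
has a smooth solution `v : [0, ∞) → 𝒰`. At `y = 0` the derivative is one-sided. -/
def viscousLayerSet {N : ℕ} (𝒰 : Set (EuclideanSpace ℝ (Fin N)))
    (f : EuclideanSpace ℝ (Fin N) → EuclideanSpace ℝ (Fin N))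
    (B : EuclideanSpace ℝ (Fin N) → EuclideanSpace ℝ (Fin N) →L[ℝ] EuclideanSpace ℝ (Fin N))
    (uB : EuclideanSpace ℝ (Fin N)) : Set (EuclideanSpace ℝ (Fin N)) :=
  {w | w ∈ 𝒰 ∧ ∃ v : ℝ → EuclideanSpace ℝ (Fin N),
    ContDiffOn ℝ ∞ v (Ici 0) ∧
    (∀ y, 0 ≤ y → v y ∈ 𝒰) ∧
    (∀ y, 0 ≤ y → B (v y) (derivWithin v (Ici 0) y) = f (v y) - f w) ∧
    v 0 = uB ∧
    Tendsto v atTop (𝓝 w)}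

/-- `(U, F)` is a `B`-convex entropy pair on `𝒰` for the flux `f`: both functions are `C²`,
`∇F = ∇U ∇f`, and `∇²U B > 0` as a quadratic form. -/
def IsBConvexEntropyPair {N : ℕ} (𝒰 : Set (EuclideanSpace ℝ (Fin N)))
    (f : EuclideanSpace ℝ (Fin N) → EuclideanSpace ℝ (Fin N))
    (B : EuclideanSpace ℝ (Fin N) → EuclideanSpace ℝ (Fin N) →L[ℝ] EuclideanSpace ℝ (Fin N))
    (U F : EuclideanSpace ℝ (Fin N) → ℝ) : Prop :=
  ContDiffOn ℝ 2 U 𝒰 ∧ ContDiffOn ℝ 2 F 𝒰 ∧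
  (∀ u ∈ 𝒰, fderiv ℝ F u = (fderiv ℝ U u).comp (fderiv ℝ f u)) ∧
  (∀ u ∈ 𝒰, ∀ h, h ≠ 0 → 0 < fderiv ℝ (fderiv ℝ U) u h (B u h))

/-- `M` is an embedded `C¹` submanifold of dimension `p`: around each of its points a `C¹`
diffeomorphism between open sets straightens `M` to a `p`-dimensional linear subspace. -/
def IsC1Submanifold {N : ℕ} (p : ℕ) (M : Set (EuclideanSpace ℝ (Fin N))) : Prop :=
  ∀ x ∈ M, ∃ (Φ : OpenPartialHomeomorph (EuclideanSpace ℝ (Fin N)) (EuclideanSpace ℝ (Fin N)))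
    (L : Submodule ℝ (EuclideanSpace ℝ (Fin N))),
    x ∈ Φ.source ∧
    ContDiffOn ℝ 1 Φ Φ.source ∧ ContDiffOn ℝ 1 Φ.symm Φ.target ∧
    Module.finrank ℝ L = p ∧
    ∀ z ∈ Φ.source, z ∈ M ↔ Φ z ∈ L

/-- The tangent vectors of `M` at `x`: velocities at time `0` of `C¹` curves in `M` through `x`. -/
def tangentVectors {N : ℕ} (M : Set (EuclideanSpace ℝ (Fin N))) (x : EuclideanSpace ℝ (Fin N)) :
    Set (EuclideanSpace ℝ (Fin N)) :=
  {w | ∃ γ : ℝ → EuclideanSpace ℝ (Fin N),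
    ContDiffAt ℝ 1 γ 0 ∧ γ 0 = x ∧ deriv γ 0 = w ∧ ∀ᶠ t in 𝓝 0, γ t ∈ M}

/-- Near its point `x`, the set `S` is a `C¹` submanifold of dimension `p` whose tangent space
at `x` is `T`. -/
def IsLocallySubmanifoldAt {N : ℕ} (p : ℕ) (S : Set (EuclideanSpace ℝ (Fin N)))
    (x : EuclideanSpace ℝ (Fin N)) (T : Submodule ℝ (EuclideanSpace ℝ (Fin N))) : Prop :=
  ∃ W : Set (EuclideanSpace ℝ (Fin N)), IsOpen W ∧ x ∈ W ∧ x ∈ S ∧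
    IsC1Submanifold p (S ∩ W) ∧ tangentVectors (S ∩ W) x = (T : Set (EuclideanSpace ℝ (Fin N)))

/-! Near `uB` the matrix `B` is invertible, and the layer equation becomes `v' = Q(v, w) (v - w)`,
with `Q(v, w)` the product of `B(v)⁻¹` and the average of `∇f` over the segment from `w` to `v`
(`exists_profileOperator`). At `(uB, uB)` this operator is diagonal in the basis `r j`, with
eigenvalues `μ j` of the same signs as `lam j`.

The limit state `w` is the parameter. Put `v = w + e^{-ηy} ζ` with `η` half the spectral gap. The
shifted eigenvalues `μ j + η` do not vanish: the first `p` stay negative, and the others, including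
a possible zero eigenvalue, become positive. Bounded `ζ` are thus the solutions of a Lyapunov–Perron
equation whose nonlinear part vanishes to first order, and the implicit function theorem in bounded
continuous functions yields a `C¹` family `Z w` with the stable coordinates of `uB - w` at time `0`
(`exists_weightedProfile`). The profile starts at `uB` exactly if the remaining coordinates of `Z w
0` also agree with those of `uB - w`. A map `θ` with `θ uB = 0` and identity derivative turns these
conditions into `θ w ∈ L`, where `L` is the span of the stable eigenvectors
(`exists_straightening`). So `θ⁻¹(L)` is a `p`-dimensional submanifold of limit states near `uB`,
which is statement 1.

Statement 2 needs the converse: every profile with limit near `uB` is in the family. If no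
eigenvalue vanishes, profiles that stay near `uB` decay exponentially
(`exists_decay_of_hyperbolic`), so their rescalings are bounded and small, and uniqueness in the
implicit function theorem applies. That profiles stay near `uB` is built into the domain in (b). In
(a) it follows from entropy dissipation, which bounds the growth of `‖v - w‖²`
(`IsBConvexEntropyPair.eventually_profile_mem_ball`). -/

open scoped NNReal BoundedContinuousFunction

/-! ### Differentiability of superposition operators in the sup norm. -/

section Superposition

variable {X : Type*} [TopologicalSpace X]
  {E : Type*} [NormedAddCommGroup E] {F : Type*} [NormedAddCommGroup F]

/-- The superposition operator `ζ ↦ φ ∘ ζ` on bounded continuous functions. -/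
def superposition [ProperSpace E] (φ : E → F) (hφ : Continuous φ) (ζ : X →ᵇ E) : X →ᵇ F where
  toFun x := φ (ζ x)
  continuous_toFun := hφ.comp ζ.continuous
  map_bounded' := by
    have hb : Bornology.IsBounded (φ '' Metric.closedBall 0 ‖ζ‖) :=
      ((isCompact_closedBall (0 : E) ‖ζ‖).image hφ).isBounded
    obtain ⟨C, hC⟩ := Metric.isBounded_iff.1 hb
    exact ⟨C, fun x y => hC
      (mem_image_of_mem φ (mem_closedBall_zero_iff.2 (ζ.norm_coe_le_norm x)))
      (mem_image_of_mem φ (mem_closedBall_zero_iff.2 (ζ.norm_coe_le_norm y)))⟩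

@[simp]
theorem superposition_apply [ProperSpace E] (φ : E → F) (hφ : Continuous φ) (ζ : X →ᵇ E) (x : X) :
    superposition φ hφ ζ x = φ (ζ x) := rfl

/-- A bounded function takes its values in a compact ball, where `φ` is uniformly continuous; this
holds without compactness of `X`. Radius `‖ζ‖ + 1` and `δ ≤ 1` leave room for the perturbed values.
-/
theorem exists_uniform_modulus [ProperSpace E] {φ : E → F} (hφ : Continuous φ) (ζ : X →ᵇ E)
    {ε : ℝ} (hε : 0 < ε) :
    ∃ δ > 0, ∀ x, ∀ e, ‖e - ζ x‖ < δ → ‖φ e - φ (ζ x)‖ < ε := by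
  have hu := (isCompact_closedBall (0 : E) (‖ζ‖ + 1)).uniformContinuousOn_of_continuous
    hφ.continuousOn
  obtain ⟨δ, hδ, h⟩ := Metric.uniformContinuousOn_iff.1 hu ε hε
  refine ⟨min δ 1, by positivity, fun x e he => ?_⟩
  have h1 : ‖ζ x‖ ≤ ‖ζ‖ := ζ.norm_coe_le_norm x
  have h2 : ‖e‖ ≤ ‖ζ‖ + 1 := by
    have h3 : ‖e‖ ≤ ‖e - ζ x‖ + ‖ζ x‖ := by simpa using norm_add_le (e - ζ x) (ζ x)
    have h4 := he.trans_le (min_le_right _ _)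
    linarith
  have := h e (mem_closedBall_zero_iff.2 h2) (ζ x)
    (mem_closedBall_zero_iff.2 (by linarith)) (by
      rw [dist_eq_norm]; exact he.trans_le (min_le_left _ _))
  rwa [dist_eq_norm] at this

theorem continuous_superposition [ProperSpace E] {φ : E → F} (hφ : Continuous φ) :
    Continuous (superposition (X := X) φ hφ) := by
  rw [Metric.continuous_iff]
  intro ζ ε hε
  obtain ⟨δ, hδ, h⟩ := exists_uniform_modulus hφ ζ (half_pos hε)
  refine ⟨δ, hδ, fun ξ hξ => ?_⟩
  refine lt_of_le_of_lt ((BoundedContinuousFunction.dist_le (half_pos hε).le).2 fun x => ?_)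
    (half_lt_self hε)
  rw [dist_eq_norm]
  refine (h x (ξ x) ?_).le
  rw [← dist_eq_norm]
  exact (BoundedContinuousFunction.dist_coe_le_dist x).trans_lt hξ

variable [NormedSpace ℝ E] [NormedSpace ℝ F]

/-- Pointwise application of operator-valued functions, as a continuous bilinear map. -/
noncomputable def pointwiseApply (X : Type*) [TopologicalSpace X]
    (E : Type*) [NormedAddCommGroup E] [NormedSpace ℝ E]
    (F : Type*) [NormedAddCommGroup F] [NormedSpace ℝ F] :
    (X →ᵇ (E →L[ℝ] F)) →L[ℝ] (X →ᵇ E) →L[ℝ] (X →ᵇ F) :=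
  LinearMap.mkContinuous₂
    (LinearMap.mk₂ ℝ
      (fun (M : X →ᵇ (E →L[ℝ] F)) (ζ : X →ᵇ E) =>
        BoundedContinuousFunction.ofNormedAddCommGroup (fun x => M x (ζ x))
          (M.continuous.clm_apply ζ.continuous) (‖M‖ * ‖ζ‖) fun x =>
            (M x).le_of_opNorm_le_of_le (M.norm_coe_le_norm x) (ζ.norm_coe_le_norm x))
      (fun _ _ _ => by ext; simp) (fun _ _ _ => by ext; simp)
      (fun _ _ _ => by ext; simp) (fun _ _ _ => by ext; simp))
    1 (fun M ζ => by
      rw [one_mul]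
      exact (BoundedContinuousFunction.norm_le (by positivity)).2 fun x =>
        (M x).le_of_opNorm_le_of_le (M.norm_coe_le_norm x) (ζ.norm_coe_le_norm x))

@[simp]
theorem pointwiseApply_apply (M : X →ᵇ (E →L[ℝ] F)) (ζ : X →ᵇ E) (x : X) :
    pointwiseApply X E F M ζ x = M x (ζ x) := rfl

/-- The mean value inequality bounds the Taylor remainder at each point by the oscillation of
`fderiv ℝ φ`, which is small uniformly in the point. -/
theorem hasFDerivAt_superposition [ProperSpace E] {φ : E → F} (hφ : ContDiff ℝ 1 φ)
    (ζ : X →ᵇ E) :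
    HasFDerivAt (superposition (X := X) φ hφ.continuous)
      (pointwiseApply X E F
        (superposition (fderiv ℝ φ) (hφ.continuous_fderiv one_ne_zero) ζ)) ζ := by
  rw [hasFDerivAt_iff_isLittleO, Asymptotics.isLittleO_iff]
  intro ε hε
  obtain ⟨δ, hδ, h⟩ := exists_uniform_modulus (hφ.continuous_fderiv one_ne_zero) ζ hε
  filter_upwards [Metric.ball_mem_nhds ζ hδ] with ξ hξ
  refine (BoundedContinuousFunction.norm_le (by positivity)).2 fun x => ?_
  have hx : ‖ξ x - ζ x‖ ≤ ‖ξ - ζ‖ := (ξ - ζ).norm_coe_le_norm x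
  have hlt : ‖ξ x - ζ x‖ < δ := hx.trans_lt (by simpa [dist_eq_norm] using hξ)
  have hmv := (convex_ball (ζ x) δ).norm_image_sub_le_of_norm_fderiv_le'
    (f := φ) (φ := fderiv ℝ φ (ζ x)) (C := ε) (x := ζ x) (y := ξ x)
    (fun e _ => (hφ.differentiable one_ne_zero) e)
    (fun e he => (h x e (by simpa [dist_eq_norm] using he)).le)
    (Metric.mem_ball_self hδ) (by simpa [dist_eq_norm] using hlt)
  simpa using hmv.trans (mul_le_mul_of_nonneg_left hx hε.le)

theorem contDiff_superposition [ProperSpace E] {φ : E → F} (hφ : ContDiff ℝ 1 φ) :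
    ContDiff ℝ 1 (superposition (X := X) φ hφ.continuous) :=
  contDiff_one_iff_hasFDerivAt.2 ⟨_, (pointwiseApply X E F).continuous.comp
    (continuous_superposition (hφ.continuous_fderiv one_ne_zero)),
    hasFDerivAt_superposition hφ⟩

end Superposition

/-! ### Hadamard factorization and global extension of germs. -/

section AveragedDerivative

variable {E : Type*} [NormedAddCommGroup E] [NormedSpace ℝ E] [ProperSpace E]
  {F : Type*} [NormedAddCommGroup F] [NormedSpace ℝ F]

/-- Integration over the unit interval as a continuous linear functional. -/
noncomputable def unitIntervalMean (F : Type*) [NormedAddCommGroup F] [NormedSpace ℝ F] :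
    (unitInterval →ᵇ F) →L[ℝ] F :=
  LinearMap.mkContinuous
    { toFun := fun h => ∫ t in (0 : ℝ)..1, h (projIcc 0 1 zero_le_one t)
      map_add' := fun g h => by
        simp only [BoundedContinuousFunction.add_apply]
        exact intervalIntegral.integral_add
          ((g.continuous.comp continuous_projIcc).intervalIntegrable _ _)
          ((h.continuous.comp continuous_projIcc).intervalIntegrable _ _)
      map_smul' := fun c h => by
        simp only [BoundedContinuousFunction.smul_apply, RingHom.id_apply]
        exact intervalIntegral.integral_smul _ _ }
    1 (fun h => by
      have := intervalIntegral.norm_integral_le_of_norm_le_const (a := 0) (b := 1) (C := ‖h‖)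
        (f := fun t => h (projIcc 0 1 zero_le_one t)) (fun t _ => h.norm_coe_le_norm _)
      simpa using this)

/-- The segments `t ↦ w + t (v - w)`, as a continuous linear function of `(v, w)`. -/
noncomputable def segmentMap (E : Type*) [NormedAddCommGroup E] [NormedSpace ℝ E] :
    E × E →L[ℝ] (unitInterval →ᵇ E) :=
  LinearMap.mkContinuous
    { toFun := fun z => BoundedContinuousFunction.mkOfCompact
        ⟨fun t : unitInterval => z.2 + (t : ℝ) • (z.1 - z.2), by fun_prop⟩
      map_add' := fun y z => by
        ext t; simp only [BoundedContinuousFunction.mkOfCompact_apply, ContinuousMap.coe_mk,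
          BoundedContinuousFunction.add_apply, Prod.fst_add, Prod.snd_add]; module
      map_smul' := fun c z => by
        ext t; simp only [BoundedContinuousFunction.mkOfCompact_apply, ContinuousMap.coe_mk,
          BoundedContinuousFunction.smul_apply, Prod.smul_fst, Prod.smul_snd,
          RingHom.id_apply]; module }
    3 (fun z => by
      refine (BoundedContinuousFunction.norm_le (by positivity)).2 fun t => ?_
      have h1 := norm_fst_le z
      have h2 := norm_snd_le z
      calc ‖z.2 + (t : ℝ) • (z.1 - z.2)‖ ≤ ‖z.2‖ + ‖(t : ℝ) • (z.1 - z.2)‖ := norm_add_le _ _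
        _ ≤ ‖z.2‖ + 1 * (‖z.1‖ + ‖z.2‖) := by
          rw [norm_smul]
          gcongr
          · rw [Real.norm_eq_abs, abs_of_nonneg t.2.1]; exact t.2.2
          · exact norm_sub_le _ _
        _ ≤ 3 * ‖z‖ := by linarith)

/-- Hadamard's lemma: differences of a `C²` map factor through a `C¹` family of operators. -/
theorem exists_contDiff_factor [CompleteSpace F] {f : E → F} (hf : ContDiff ℝ 2 f) :
    ∃ q : E × E → (E →L[ℝ] F), ContDiff ℝ 1 q ∧ (∀ v w, q (v, w) (v - w) = f v - f w) ∧
      ∀ u, q (u, u) = fderiv ℝ f u := by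
  have hd : ContDiff ℝ 1 (fderiv ℝ f) := hf.fderiv_right (by norm_num [one_add_one_eq_two])
  -- The averaged derivative is a composition of two continuous linear maps with the superposition
  -- operator of `fderiv ℝ f` in between, so its regularity needs no differentiation under the
  -- integral.
  refine ⟨fun z => unitIntervalMean _
    (superposition (fderiv ℝ f) hd.continuous (segmentMap E z)), ?_, ?_, ?_⟩
  · exact (unitIntervalMean _).contDiff.comp
      ((contDiff_superposition hd).comp (segmentMap E).contDiff)
  · intro v w
    have hc : Continuous fun t : ℝ => fderiv ℝ f (w + t • (v - w)) :=
      hd.continuous.comp (by fun_prop)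
    have h0 : unitIntervalMean _
        (superposition (fderiv ℝ f) hd.continuous (segmentMap E (v, w))) =
        ∫ t in (0 : ℝ)..1, fderiv ℝ f (w + t • (v - w)) := by
      change (∫ t in (0 : ℝ)..1, fderiv ℝ f (w + ((projIcc (0 : ℝ) 1 zero_le_one t : unitInterval) : ℝ) • (v - w))) = _
      refine intervalIntegral.integral_congr fun t ht => ?_
      rw [uIcc_of_le zero_le_one] at ht
      simp only [projIcc_of_mem zero_le_one ht]
    simp only [h0]
    rw [ContinuousLinearMap.intervalIntegral_apply (hc.intervalIntegrable _ _)]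
    have hder : ∀ t ∈ uIcc (0 : ℝ) 1, HasDerivAt (fun t : ℝ => f (w + t • (v - w)))
        (fderiv ℝ f (w + t • (v - w)) (v - w)) t := by
      intro t _
      have h1 : HasDerivAt (fun t : ℝ => w + t • (v - w)) (v - w) t := by
        simpa using ((hasDerivAt_id t).smul_const (v - w)).const_add w
      exact ((hf.differentiable two_ne_zero) _).hasFDerivAt.comp_hasDerivAt t h1
    rw [intervalIntegral.integral_eq_sub_of_hasDerivAt hder
      ((hc.clm_apply continuous_const).intervalIntegrable _ _)]
    simp
  · intro u
    change (∫ t in (0 : ℝ)..1, fderiv ℝ f (u + ((projIcc (0 : ℝ) 1 zero_le_one t : unitInterval) : ℝ) • (u - u))) = _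
    simp

end AveragedDerivative

/-- A germ of class `C^n` in finite dimensions extends to a globally `C^n` map. -/
theorem exists_contDiff_eventuallyEq {E : Type*} [NormedAddCommGroup E] [NormedSpace ℝ E]
    [FiniteDimensional ℝ E] {F : Type*} [NormedAddCommGroup F] [NormedSpace ℝ F] {n : ℕ}
    {f : E → F} {x : E} (hf : ContDiffAt ℝ n f x) :
    ∃ g : E → F, ContDiff ℝ n g ∧ g =ᶠ[𝓝 x] f := by
  obtain ⟨ε, hε, hball⟩ := Metric.eventually_nhds_iff_ball.1 (hf.eventually (by simp))
  let χ : ContDiffBump x := ⟨ε / 3, ε / 2, by positivity, by linarith⟩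
  refine ⟨fun y => χ y • f y, contDiff_iff_contDiffAt.2 fun y => ?_, ?_⟩
  · by_cases hy : y ∈ Metric.ball x ε
    · exact χ.contDiff.contDiffAt.smul (hball y hy)
    · have hy' : y ∉ tsupport χ := by
        rw [χ.tsupport_eq]
        simp only [Metric.mem_ball, not_lt, Metric.mem_closedBall, not_le, χ] at hy ⊢
        linarith
      have h0 : (fun y => χ y • f y) =ᶠ[𝓝 y] fun _ => 0 := by
        filter_upwards [notMem_tsupport_iff_eventuallyEq.1 hy'] with z hz
        simp [hz]
      exact contDiffAt_const.congr_of_eventuallyEq h0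
  · filter_upwards [χ.eventuallyEq_one] with y hy
    simp [hy]

/-! ### Bounded solutions of scalar linear equations on the half line. -/

section HalfLine

variable {F : Type*} [NormedAddCommGroup F]

/-- The extension to the real line of a function on the half line, constant for negative times. -/
def extendHalfLine (x : ℝ≥0 →ᵇ F) (y : ℝ) : F := x y.toNNReal

theorem continuous_extendHalfLine (x : ℝ≥0 →ᵇ F) : Continuous (extendHalfLine x) :=
  x.continuous.comp continuous_real_toNNReal

theorem norm_extendHalfLine_le (x : ℝ≥0 →ᵇ F) (y : ℝ) : ‖extendHalfLine x y‖ ≤ ‖x‖ :=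
  x.norm_coe_le_norm _

theorem extendHalfLine_coe (x : ℝ≥0 →ᵇ F) (y : ℝ≥0) : extendHalfLine x y = x y := by
  simp [extendHalfLine]

theorem extendHalfLine_zero (x : ℝ≥0 →ᵇ F) : extendHalfLine x 0 = x 0 := by
  simp [extendHalfLine]

end HalfLine

/-- The only bounded solution of `d' = a d` on the half line, with `d 0 = 0` if `a < 0`,
vanishes. -/
theorem eq_zero_of_hasDerivWithinAt_mul {a : ℝ} {d : ℝ≥0 →ᵇ ℝ} (ha : a ≠ 0)
    (h0 : a < 0 → d 0 = 0)
    (hd : ∀ y, 0 ≤ y → HasDerivWithinAt (extendHalfLine d) (a * extendHalfLine d y) (Ici 0) y) :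
    d = 0 := by
  have hconst : ∀ y : ℝ, 0 ≤ y → extendHalfLine d y * Real.exp (-a * y) = d 0 := by
    intro y hy
    have hcont : ContinuousOn (fun y => extendHalfLine d y * Real.exp (-a * y)) (Icc 0 y) :=
      ((continuous_extendHalfLine d).mul (by fun_prop)).continuousOn
    have := constant_of_has_deriv_right_zero hcont (fun t ht => by
      have h1 := (hd t ht.1).mono (Ici_subset_Ici.2 ht.1)
      have h2 : HasDerivWithinAt (fun y => Real.exp (-a * y)) (Real.exp (-a * t) * -a)
          (Ici t) t := by
        simpa using (((hasDerivAt_id t).const_mul (-a)).exp).hasDerivWithinAt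
      refine (h1.mul h2).congr_deriv ?_
      ring) y (right_mem_Icc.2 hy)
    simpa [extendHalfLine_zero] using this
  -- For `a > 0` boundedness replaces the initial condition: the constant `d 0` equals a bounded
  -- function times a decaying exponential.
  have hz : d 0 = 0 := by
    rcases ha.lt_or_gt with h | h
    · exact h0 h
    · have hlim : Tendsto (fun y : ℝ => extendHalfLine d y * Real.exp (-a * y)) atTop (𝓝 0) := by
        have he : Tendsto (fun y : ℝ => Real.exp (-a * y)) atTop (𝓝 0) :=
          Real.tendsto_exp_atBot.comp (tendsto_id.const_mul_atTop_of_neg (neg_lt_zero.2 h))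
        have hbd : IsBoundedUnder (· ≤ ·) atTop (norm ∘ extendHalfLine d) :=
          isBoundedUnder_of ⟨‖d‖, norm_extendHalfLine_le d⟩
        exact isBoundedUnder_le_mul_tendsto_zero hbd he
      refine tendsto_nhds_unique (tendsto_const_nhds.congr' ?_) hlim
      filter_upwards [eventually_ge_atTop 0] with y hy
      exact (hconst y hy).symm
  ext y
  have := hconst y y.2
  rw [hz, extendHalfLine_coe] at this
  simpa [Real.exp_ne_zero] using this

/-- The primitive of `e^{-as} h(s)` that yields, multiplied by `e^{ay}`, the bounded solution of
`x' = a x + h`. -/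
noncomputable def weightedPrimitive (a : ℝ) (h : ℝ≥0 →ᵇ ℝ) (y : ℝ) : ℝ :=
  (∫ s in (0 : ℝ)..y, Real.exp (-a * s) * extendHalfLine h s) -
    if 0 < a then ∫ s in Ioi (0 : ℝ), Real.exp (-a * s) * extendHalfLine h s else 0

theorem continuous_exp_mul_extendHalfLine (a : ℝ) (h : ℝ≥0 →ᵇ ℝ) :
    Continuous fun s => Real.exp (-a * s) * extendHalfLine h s :=
  (by fun_prop : Continuous fun s => Real.exp (-a * s)).mul (continuous_extendHalfLine h)

theorem integrableOn_exp_mul_extendHalfLine {a : ℝ} (ha : 0 < a) (h : ℝ≥0 →ᵇ ℝ) (y : ℝ) :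
    MeasureTheory.IntegrableOn (fun s => Real.exp (-a * s) * extendHalfLine h s) (Ioi y) := by
  refine MeasureTheory.Integrable.mul_bdd (c := ‖h‖) (integrableOn_exp_mul_Ioi (neg_lt_zero.2 ha) y)
    (continuous_extendHalfLine h).aestronglyMeasurable
    (Eventually.of_forall fun s => norm_extendHalfLine_le h s)

theorem hasDerivAt_exp_mul_weightedPrimitive (a : ℝ) (h : ℝ≥0 →ᵇ ℝ) (y : ℝ) :
    HasDerivAt (fun y => Real.exp (a * y) * weightedPrimitive a h y)
      (a * (Real.exp (a * y) * weightedPrimitive a h y) + extendHalfLine h y) y := by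
  have hc := continuous_exp_mul_extendHalfLine a h
  have h1 : HasDerivAt (weightedPrimitive a h) (Real.exp (-a * y) * extendHalfLine h y) y :=
    (intervalIntegral.integral_hasDerivAt_right (hc.intervalIntegrable _ _)
      (hc.stronglyMeasurableAtFilter _ _) hc.continuousAt).sub_const _
  have h2 : HasDerivAt (fun y => Real.exp (a * y)) (Real.exp (a * y) * a) y := by
    simpa using ((hasDerivAt_id y).const_mul a).exp
  refine (h2.mul h1).congr_deriv ?_
  have h3 : Real.exp (a * y) * Real.exp (-a * y) = 1 := by
    rw [← Real.exp_add]; simp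
  linear_combination extendHalfLine h y * h3

/-- For `a < 0` the primitive integrates forward from `0`; for `a > 0` it is minus the integral from
`y` to infinity. In both cases the kernel `e^{a(y-s)}` has total mass at most `|a|⁻¹`. -/
theorem abs_exp_mul_weightedPrimitive_le {a : ℝ} (ha : a ≠ 0) (h : ℝ≥0 →ᵇ ℝ) {y : ℝ}
    (hy : 0 ≤ y) :
    |Real.exp (a * y) * weightedPrimitive a h y| ≤ |a|⁻¹ * ‖h‖ := by
  have hc := continuous_exp_mul_extendHalfLine a h
  have hpt : ∀ s, ‖Real.exp (-a * s) * extendHalfLine h s‖ ≤ Real.exp (-a * s) * ‖h‖ := by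
    intro s
    rw [norm_mul, Real.norm_of_nonneg (Real.exp_pos _).le]
    gcongr
    exact norm_extendHalfLine_le h s
  have hexp : Real.exp (a * y) * Real.exp (-a * y) = 1 := by
    rw [← Real.exp_add]; simp
  rw [abs_mul, abs_of_pos (Real.exp_pos _)]
  rcases ha.lt_or_gt with hneg | hpos
  · have h1 : |weightedPrimitive a h y| ≤ ∫ s in (0 : ℝ)..y, Real.exp (-a * s) * ‖h‖ := by
      rw [weightedPrimitive, if_neg (not_lt.2 hneg.le), sub_zero, ← Real.norm_eq_abs]
      refine intervalIntegral.norm_integral_le_of_norm_le hy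
        (Eventually.of_forall fun s _ => hpt s)
        ((by fun_prop : Continuous fun s => Real.exp (-a * s) * ‖h‖).intervalIntegrable _ _)
    have h2 : ∫ s in (0 : ℝ)..y, Real.exp (-a * s) * ‖h‖ =
        (-a)⁻¹ * (Real.exp (-a * y) - 1) * ‖h‖ := by
      rw [intervalIntegral.integral_mul_const,
        intervalIntegral.integral_comp_mul_left _ (neg_ne_zero.2 ha)]
      simp
    rw [abs_of_neg hneg]
    calc Real.exp (a * y) * |weightedPrimitive a h y|
        ≤ Real.exp (a * y) * ((-a)⁻¹ * (Real.exp (-a * y) - 1) * ‖h‖) := by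
          rw [← h2]; gcongr
      _ = (-a)⁻¹ * (1 - Real.exp (a * y)) * ‖h‖ := by
          linear_combination ((-a)⁻¹ * ‖h‖) * hexp
      _ ≤ (-a)⁻¹ * 1 * ‖h‖ := by
          have : 0 < (-a)⁻¹ := inv_pos.2 (neg_pos.2 hneg)
          gcongr
          linarith [Real.exp_pos (a * y)]
      _ = _ := by ring
  · have h0 : weightedPrimitive a h y =
        -∫ s in Ioi y, Real.exp (-a * s) * extendHalfLine h s := by
      have := intervalIntegral.integral_interval_add_Ioi
        (integrableOn_exp_mul_extendHalfLine hpos h 0)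
        (integrableOn_exp_mul_extendHalfLine hpos h y)
      rw [weightedPrimitive, if_pos hpos, ← this]
      ring
    have h1 : |weightedPrimitive a h y| ≤ ∫ s in Ioi y, Real.exp (-a * s) * ‖h‖ := by
      rw [h0, abs_neg, ← Real.norm_eq_abs]
      exact MeasureTheory.norm_integral_le_of_norm_le
        ((integrableOn_exp_mul_Ioi (neg_lt_zero.2 hpos) y).mul_const _)
        (Eventually.of_forall hpt)
    have h2 : ∫ s in Ioi y, Real.exp (-a * s) * ‖h‖ = a⁻¹ * Real.exp (-a * y) * ‖h‖ := by
      rw [MeasureTheory.integral_mul_const, integral_exp_mul_Ioi (neg_lt_zero.2 hpos)]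
      field_simp
    rw [abs_of_pos hpos]
    calc Real.exp (a * y) * |weightedPrimitive a h y|
        ≤ Real.exp (a * y) * (a⁻¹ * Real.exp (-a * y) * ‖h‖) := by
          rw [← h2]; gcongr
      _ = a⁻¹ * ‖h‖ := by linear_combination (a⁻¹ * ‖h‖) * hexp
      _ ≤ _ := le_rfl

theorem weightedPrimitive_add (a : ℝ) (g h : ℝ≥0 →ᵇ ℝ) (y : ℝ) :
    weightedPrimitive a (g + h) y = weightedPrimitive a g y + weightedPrimitive a h y := by
  have hadd : ∀ s, Real.exp (-a * s) * extendHalfLine (g + h) s =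
      Real.exp (-a * s) * extendHalfLine g s + Real.exp (-a * s) * extendHalfLine h s :=
    fun s => mul_add _ _ _
  simp only [weightedPrimitive, hadd]
  rw [intervalIntegral.integral_add
    ((continuous_exp_mul_extendHalfLine a g).intervalIntegrable _ _)
    ((continuous_exp_mul_extendHalfLine a h).intervalIntegrable _ _)]
  split_ifs with hpos
  · rw [MeasureTheory.integral_add (integrableOn_exp_mul_extendHalfLine hpos g 0)
      (integrableOn_exp_mul_extendHalfLine hpos h 0)]
    ring
  · ring

theorem weightedPrimitive_smul (a c : ℝ) (h : ℝ≥0 →ᵇ ℝ) (y : ℝ) :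
    weightedPrimitive a (c • h) y = c * weightedPrimitive a h y := by
  have hmul : ∀ s, Real.exp (-a * s) * extendHalfLine (c • h) s =
      c * (Real.exp (-a * s) * extendHalfLine h s) := fun s => by
    simp only [extendHalfLine, BoundedContinuousFunction.smul_apply, smul_eq_mul]
    ring
  simp only [weightedPrimitive, hmul, intervalIntegral.integral_const_mul,
    MeasureTheory.integral_const_mul]
  split_ifs <;> ring

/-- Bounded solution operator of the scalar equation `x' = a x + h` on the half line. -/
theorem exists_boundedSolutionOperator {a : ℝ} (ha : a ≠ 0) :
    ∃ R : (ℝ≥0 →ᵇ ℝ) →L[ℝ] (ℝ≥0 →ᵇ ℝ),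
      (∀ h y, 0 ≤ y → HasDerivWithinAt (extendHalfLine (R h))
        (a * extendHalfLine (R h) y + extendHalfLine h y) (Ici 0) y) ∧
      (a < 0 → ∀ h, R h 0 = 0) := by
  let S : (ℝ≥0 →ᵇ ℝ) →ₗ[ℝ] (ℝ≥0 →ᵇ ℝ) :=
    { toFun := fun h => BoundedContinuousFunction.ofNormedAddCommGroup
        (fun y : ℝ≥0 => Real.exp (a * y) * weightedPrimitive a h y)
        ((continuous_iff_continuousAt.2 fun y =>
          (hasDerivAt_exp_mul_weightedPrimitive a h y).continuousAt).comp NNReal.continuous_coe)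
        (|a|⁻¹ * ‖h‖) (fun y => abs_exp_mul_weightedPrimitive_le ha h y.2)
      map_add' := fun g h => by
        ext y
        simp only [BoundedContinuousFunction.coe_ofNormedAddCommGroup,
          BoundedContinuousFunction.add_apply, weightedPrimitive_add, mul_add]
      map_smul' := fun c h => by
        ext y
        simp only [BoundedContinuousFunction.coe_ofNormedAddCommGroup, RingHom.id_apply,
          BoundedContinuousFunction.smul_apply, weightedPrimitive_smul, smul_eq_mul]
        ring }
  have hS : ∀ h (y : ℝ≥0), S h y = Real.exp (a * y) * weightedPrimitive a h y := fun _ _ => rfl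
  let R := S.mkContinuous (|a|⁻¹) (fun h =>
    (BoundedContinuousFunction.norm_le (by positivity)).2
      (fun y => abs_exp_mul_weightedPrimitive_le ha h y.2))
  have hR : ∀ h y, 0 ≤ y → extendHalfLine (R h) y = Real.exp (a * y) * weightedPrimitive a h y := by
    intro h y hy
    lift y to ℝ≥0 using hy
    rw [extendHalfLine_coe]
    exact hS h y
  refine ⟨R, fun h y hy => ?_, fun hneg h => ?_⟩
  · have := (hasDerivAt_exp_mul_weightedPrimitive a h y).hasDerivWithinAt (s := Ici 0)
    rw [← hR h y hy] at this
    exact this.congr (fun t ht => hR h t ht) (hR h y hy)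
  · have := hR h 0 le_rfl
    rw [extendHalfLine_zero] at this
    rw [this, weightedPrimitive, if_neg (not_lt.2 hneg.le)]
    simp

/-- The decaying exponential `e^{ay}` for `a < 0`; zero otherwise. -/
theorem exists_decayingExponential (a : ℝ) :
    ∃ e : ℝ≥0 →ᵇ ℝ, (a < 0 → e 0 = 1) ∧ (0 ≤ a → e = 0) ∧
      ∀ y, 0 ≤ y → HasDerivWithinAt (extendHalfLine e) (a * extendHalfLine e y) (Ici 0) y := by
  rcases lt_or_ge a 0 with ha | ha
  · let e : ℝ≥0 →ᵇ ℝ := BoundedContinuousFunction.ofNormedAddCommGroup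
      (fun y : ℝ≥0 => Real.exp (a * y)) (by fun_prop) 1 (fun y => by
        rw [Real.norm_of_nonneg (Real.exp_pos _).le, Real.exp_le_one_iff]
        exact mul_nonpos_of_nonpos_of_nonneg ha.le y.2)
    have he : ∀ y, 0 ≤ y → extendHalfLine e y = Real.exp (a * y) := by
      intro y hy
      lift y to ℝ≥0 using hy
      rw [extendHalfLine_coe]
      rfl
    refine ⟨e, fun _ => by simp [e], fun h => absurd ha (not_lt.2 h), fun y hy => ?_⟩
    have h1 : HasDerivWithinAt (fun y => Real.exp (a * y)) (Real.exp (a * y) * a) (Ici 0) y := by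
      simpa using (((hasDerivAt_id y).const_mul a).exp).hasDerivWithinAt
    rw [he y hy, mul_comm]
    exact h1.congr (fun t ht => he t ht) (he y hy)
  · refine ⟨0, fun h => absurd h (not_lt.2 ha), fun _ => rfl, fun y _ => ?_⟩
    simpa [extendHalfLine] using! hasDerivWithinAt_const y (Ici (0 : ℝ)) (0 : ℝ)

/-! ### Undoing the exponential rescaling. -/

section WeightedShift

variable {E : Type*} [NormedAddCommGroup E] [NormedSpace ℝ E]

/-- The family `y ↦ (w + e^{-ηy} ζ(y), w)`, as a continuous linear function of `(w, ζ)`. -/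
noncomputable def weightedShift {η : ℝ} (hη : 0 ≤ η) :
    E × (ℝ≥0 →ᵇ E) →L[ℝ] (ℝ≥0 →ᵇ E × E) :=
  have hbound : ∀ (z : E × (ℝ≥0 →ᵇ E)) (y : ℝ≥0),
      ‖(z.1 + Real.exp (-η * y) • z.2 y, z.1)‖ ≤ 2 * ‖z‖ := by
    intro z y
    have h1 := norm_fst_le z
    have h2 := (z.2.norm_coe_le_norm y).trans (norm_snd_le z)
    have h3 : Real.exp (-η * y) ≤ 1 :=
      Real.exp_le_one_iff.2 (by have := mul_nonneg hη y.coe_nonneg; linarith)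
    have h4 : ‖Real.exp (-η * y) • z.2 y‖ ≤ 1 * ‖z‖ := by
      rw [norm_smul, Real.norm_of_nonneg (Real.exp_pos _).le]
      gcongr
    refine max_le ?_ (by linarith [norm_nonneg z])
    exact (norm_add_le _ _).trans (by linarith)
  LinearMap.mkContinuous
    { toFun := fun z => BoundedContinuousFunction.ofNormedAddCommGroup
        (fun y : ℝ≥0 => (z.1 + Real.exp (-η * y) • z.2 y, z.1))
        (by have := z.2.continuous; fun_prop) (2 * ‖z‖) (hbound z)
      map_add' := fun x z => by
        ext y
        · simp only [BoundedContinuousFunction.coe_ofNormedAddCommGroup, Prod.fst_add,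
            Prod.snd_add, BoundedContinuousFunction.add_apply]
          module
        · rfl
      map_smul' := fun r z => by
        ext y
        · simp only [BoundedContinuousFunction.coe_ofNormedAddCommGroup, Prod.smul_fst,
            Prod.smul_snd, BoundedContinuousFunction.smul_apply, RingHom.id_apply]
          module
        · rfl }
    2 (fun z => (BoundedContinuousFunction.norm_le (by positivity)).2 (hbound z))

theorem weightedShift_apply {η : ℝ} (hη : 0 ≤ η) (z : E × (ℝ≥0 →ᵇ E)) (y : ℝ≥0) :
    weightedShift hη z y = (z.1 + Real.exp (-η * y) • z.2 y, z.1) := rfl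

end WeightedShift

/-! ### Diagonal systems and the Lyapunov–Perron equation. -/

section DiagonalSystem

variable {ι : Type*} {E : Type*} [NormedAddCommGroup E] [NormedSpace ℝ E]
  [FiniteDimensional ℝ E]

/-- The coordinate functionals of a basis, as continuous linear maps. -/
noncomputable def coordCLM (b : Module.Basis ι ℝ E) (j : ι) : E →L[ℝ] ℝ :=
  LinearMap.toContinuousLinearMap (b.coord j)

theorem coordCLM_self (b : Module.Basis ι ℝ E) (j : ι) : coordCLM b j (b j) = 1 := by
  simp [coordCLM]

theorem coordCLM_of_ne (b : Module.Basis ι ℝ E) {i j : ι} (h : i ≠ j) :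
    coordCLM b j (b i) = 0 := by
  simp [coordCLM, h]

theorem ext_coordCLM (b : Module.Basis ι ℝ E) {x y : E}
    (h : ∀ j, coordCLM b j x = coordCLM b j y) : x = y :=
  b.ext_elem h

variable [Fintype ι]

theorem sum_coordCLM_smul (b : Module.Basis ι ℝ E) (x : E) :
    ∑ j, coordCLM b j x • b j = x := b.sum_repr x

theorem coordCLM_sum_smul (b : Module.Basis ι ℝ E) (c : ι → ℝ) (j : ι) :
    coordCLM b j (∑ i, c i • b i) = c j := by
  rw [map_sum, Finset.sum_eq_single j]
  · simp [coordCLM_self]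
  · intro i _ hi
    simp [coordCLM_of_ne b hi]
  · simp

theorem coordCLM_diagonal {b : Module.Basis ι ℝ E} {L : E →L[ℝ] E} {a : ι → ℝ}
    (hL : ∀ j, L (b j) = a j • b j) (x : E) (j : ι) :
    coordCLM b j (L x) = a j * coordCLM b j x := by
  conv_lhs => rw [← sum_coordCLM_smul b x, map_sum]
  simp only [map_smul, hL, smul_smul]
  rw [coordCLM_sum_smul, mul_comm]

/-- Bounded solutions of the diagonal system `ζ' = L ζ + h` on the half line, parametrized by the
coordinates at time `0` along the decaying directions. -/
theorem exists_diagonalSolutionOperator (b : Module.Basis ι ℝ E) {a : ι → ℝ}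
    (ha : ∀ j, a j ≠ 0) {L : E →L[ℝ] E} (hL : ∀ j, L (b j) = a j • b j) :
    ∃ (S : E →L[ℝ] (ℝ≥0 →ᵇ E)) (T : (ℝ≥0 →ᵇ E) →L[ℝ] (ℝ≥0 →ᵇ E)),
      (∀ j, 0 < a j → ∀ ξ, coordCLM b j (S ξ 0) = 0) ∧
      ∀ ξ ζ h, ζ = S ξ + T h ↔
        (∀ j, a j < 0 → coordCLM b j (ζ 0) = coordCLM b j ξ) ∧
        ∀ y, 0 ≤ y → HasDerivWithinAt (extendHalfLine ζ)
          (L (extendHalfLine ζ y) + extendHalfLine h y) (Ici 0) y := by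
  choose R hRd hR0 using fun j => exists_boundedSolutionOperator (ha j)
  choose e he0 hez hed using fun j => exists_decayingExponential (a j)
  let c : ι → (ℝ≥0 →ᵇ E) →L[ℝ] (ℝ≥0 →ᵇ ℝ) := fun j =>
    (coordCLM b j).compLeftContinuousBounded ℝ≥0
  let d : ι → (ℝ≥0 →ᵇ ℝ) →L[ℝ] (ℝ≥0 →ᵇ E) := fun j =>
    ((1 : ℝ →L[ℝ] ℝ).smulRight (b j)).compLeftContinuousBounded ℝ≥0
  have hd : ∀ j x y, d j x y = x y • b j := fun _ _ _ => rfl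
  have hc : ∀ j ζ y, c j ζ y = coordCLM b j (ζ y) := fun _ _ _ => rfl
  let S : E →L[ℝ] (ℝ≥0 →ᵇ E) := ∑ j, (coordCLM b j).smulRight (d j (e j))
  let T : (ℝ≥0 →ᵇ E) →L[ℝ] (ℝ≥0 →ᵇ E) := ∑ j, (d j).comp ((R j).comp (c j))
  have hS : ∀ ξ y, S ξ y = ∑ j, (coordCLM b j ξ * e j y) • b j := by
    intro ξ y
    simp [S, hd, mul_smul]
  have hT : ∀ h y, T h y = ∑ j, (R j (c j h) y) • b j := by
    intro h y
    simp [T, hd]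
  have hcoord : ∀ ξ h j, c j (S ξ + T h) = coordCLM b j ξ • e j + R j (c j h) := by
    intro ξ h j
    ext y
    rw [hc, BoundedContinuousFunction.add_apply, map_add, hS, hT, coordCLM_sum_smul,
      coordCLM_sum_smul]
    rfl
  have hext : ∀ j ζ y, extendHalfLine (c j ζ) y = coordCLM b j (extendHalfLine ζ y) :=
    fun _ _ _ => rfl
  refine ⟨S, T, fun j hj ξ => ?_, fun ξ ζ h => ⟨?_, ?_⟩⟩
  · rw [hS, coordCLM_sum_smul, hez j hj.le]
    simp
  · rintro hζ
    have hcζ : ∀ j, c j ζ = coordCLM b j ξ • e j + R j (c j h) := fun j => hζ ▸ hcoord ξ h j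
    refine ⟨fun j hj => ?_, fun y hy => ?_⟩
    · rw [← hc, hcζ]
      simp [he0 j hj, hR0 j hj]
    · have hj : ∀ j, HasDerivWithinAt (extendHalfLine (c j ζ))
          (a j * extendHalfLine (c j ζ) y + extendHalfLine (c j h) y) (Ici 0) y := by
        intro j
        have h1 := ((hed j y hy).const_mul (coordCLM b j ξ)).add (hRd j (c j h) y hy)
        rw [hcζ j]
        refine h1.congr_deriv ?_
        simp only [extendHalfLine, BoundedContinuousFunction.add_apply,
          BoundedContinuousFunction.smul_apply, smul_eq_mul]
        ring
      have hsum := HasDerivWithinAt.fun_sum (u := Finset.univ)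
        (fun j _ => (hj j).smul_const (b j))
      have h2 : (fun y => ∑ j, extendHalfLine (c j ζ) y • b j) = extendHalfLine ζ := by
        funext y
        simp only [hext, sum_coordCLM_smul]
      rw [h2] at hsum
      refine hsum.congr_deriv (ext_coordCLM b fun j => ?_)
      rw [coordCLM_sum_smul, map_add, coordCLM_diagonal hL, hext, hext]
  · rintro ⟨h0, hder⟩
    -- Each coordinate of the difference is a bounded solution of the homogeneous scalar equation,
    -- vanishing at `0` in the decaying directions.
    have hzero : ∀ j, c j ζ - c j (S ξ + T h) = 0 := by
      intro j
      refine eq_zero_of_hasDerivWithinAt_mul (ha j) (fun hj => ?_) (fun y hy => ?_)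
      · rw [hcoord, BoundedContinuousFunction.sub_apply, hc, h0 j hj]
        simp [he0 j hj, hR0 j hj]
      · have h1 : HasDerivWithinAt (extendHalfLine (c j ζ))
            (coordCLM b j (L (extendHalfLine ζ y) + extendHalfLine h y)) (Ici 0) y :=
          (coordCLM b j).hasFDerivAt.comp_hasDerivWithinAt y (hder y hy)
        have h2 := ((hed j y hy).const_mul (coordCLM b j ξ)).add (hRd j (c j h) y hy)
        rw [hcoord]
        refine (h1.sub h2).congr_deriv ?_
        rw [map_add, coordCLM_diagonal hL]
        simp only [extendHalfLine, BoundedContinuousFunction.add_apply,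
          BoundedContinuousFunction.sub_apply,
          BoundedContinuousFunction.smul_apply, smul_eq_mul, hc]
        ring
    ext y
    refine ext_coordCLM b fun j => ?_
    rw [← hc, ← hc, sub_eq_zero.1 (hzero j)]

/-- The `C¹` family of profiles that decay like `e^{-ηy}`: for the limit state `w` near `u`, the
rescaled profile `ζ = e^{ηy} (v - w)` of a solution of `v' = Q(v, w) (v - w)` with the same stable
coordinates at `0` as `u - w` is `Z w`. -/
theorem exists_weightedProfile (b : Module.Basis ι ℝ E) {μ : ι → ℝ} {η : ℝ} (hη : 0 ≤ η)
    (ha : ∀ j, μ j + η ≠ 0) {Q : E × E → (E →L[ℝ] E)} (hQ : ContDiff ℝ 1 Q) {u : E}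
    (hQu : ∀ j, Q (u, u) (b j) = μ j • b j) :
    ∃ Z : E → (ℝ≥0 →ᵇ E), Z u = 0 ∧ ContDiffAt ℝ 1 Z u ∧
      (∀ j, 0 < μ j + η → HasFDerivAt (fun w => coordCLM b j (Z w 0)) (0 : E →L[ℝ] ℝ) u) ∧
      ∀ᶠ z : E × (ℝ≥0 →ᵇ E) in 𝓝 (u, 0), Z z.1 = z.2 ↔
        (∀ j, μ j + η < 0 → coordCLM b j (z.2 0) = coordCLM b j (u - z.1)) ∧
        ∀ y, 0 ≤ y → HasDerivWithinAt (extendHalfLine z.2)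
          (Q (z.1 + Real.exp (-η * y) • extendHalfLine z.2 y, z.1) (extendHalfLine z.2 y) +
            η • extendHalfLine z.2 y) (Ici 0) y := by
  have : CompleteSpace E := FiniteDimensional.complete ℝ E
  have : ProperSpace E := FiniteDimensional.proper_real E
  set A := Q (u, u) with hA
  obtain ⟨S, T, hS, hST⟩ := exists_diagonalSolutionOperator b ha
    (L := A + η • ContinuousLinearMap.id ℝ E) (fun j => by simp [hQu, add_smul])
  let P : E × (ℝ≥0 →ᵇ E) → (ℝ≥0 →ᵇ (E →L[ℝ] E)) := fun z =>
    superposition Q hQ.continuous (weightedShift hη z)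
  have hW : ContDiff ℝ 1 (weightedShift (E := E) hη) := ContinuousLinearMap.contDiff _
  have hP : ContDiff ℝ 1 P := (contDiff_superposition hQ).comp hW
  -- The nonlinear part `(Q(v, w) - A) ζ`. It is a product of two factors that both vanish at `(u,
  -- 0)`, hence has zero derivative there.
  let M : E × (ℝ≥0 →ᵇ E) → (ℝ≥0 →ᵇ E) := fun z =>
    pointwiseApply _ _ _ (P z) z.2 - A.compLeftContinuousBounded ℝ≥0 z.2
  have happly : ContDiff ℝ 1 (pointwiseApply ℝ≥0 E E) := ContinuousLinearMap.contDiff _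
  have hM : ContDiff ℝ 1 M :=
    ((happly.comp hP).clm_apply contDiff_snd).sub
      ((A.compLeftContinuousBounded ℝ≥0).contDiff.comp contDiff_snd)
  have hMd : HasFDerivAt M (0 : E × (ℝ≥0 →ᵇ E) →L[ℝ] (ℝ≥0 →ᵇ E)) (u, 0) := by
    have h1 := ((pointwiseApply ℝ≥0 E E).hasFDerivAt_of_bilinear
      ((hP.differentiable one_ne_zero) (u, 0)).hasFDerivAt
      (hasFDerivAt_snd (𝕜 := ℝ) (p := (u, (0 : ℝ≥0 →ᵇ E))))).sub
      ((A.compLeftContinuousBounded ℝ≥0).hasFDerivAt.comp (u, (0 : ℝ≥0 →ᵇ E))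
        (hasFDerivAt_snd (𝕜 := ℝ)))
    refine h1.congr_fderiv ?_
    ext z y
    · simp
    · simp [P, weightedShift_apply, hA]
  -- The zeros of `G` are the bounded rescaled solutions with the stable data of `u - w`. At `(u,
  -- 0)` the partial derivative of `G` in `ζ` is the identity, since `M` does not contribute.
  let G : E × (ℝ≥0 →ᵇ E) → (ℝ≥0 →ᵇ E) := fun z => z.2 - S (u - z.1) - T (M z)
  have hG : ContDiff ℝ 1 G :=
    (contDiff_snd.sub (S.contDiff.comp (contDiff_const.sub contDiff_fst))).sub
      (T.contDiff.comp hM)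
  have hGd : HasFDerivAt G (ContinuousLinearMap.snd ℝ E (ℝ≥0 →ᵇ E) +
      S.comp (ContinuousLinearMap.fst ℝ E (ℝ≥0 →ᵇ E))) (u, 0) := by
    have h1 := ((hasFDerivAt_snd (𝕜 := ℝ) (p := (u, (0 : ℝ≥0 →ᵇ E)))).sub
      (S.hasFDerivAt.comp (u, (0 : ℝ≥0 →ᵇ E))
        ((hasFDerivAt_fst (𝕜 := ℝ) (p := (u, (0 : ℝ≥0 →ᵇ E)))).const_sub u))).sub
      (T.hasFDerivAt.comp (u, (0 : ℝ≥0 →ᵇ E)) hMd)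
    refine h1.congr_fderiv ?_
    ext z y <;> simp
  have hM0 : M (u, 0) = 0 := by simp [M]
  have hG0 : G (u, 0) = 0 := by simp [G, hM0]
  have hinr : (fderiv ℝ G (u, 0) ∘L .inr ℝ E (ℝ≥0 →ᵇ E)) = ContinuousLinearMap.id ℝ _ := by
    rw [hGd.fderiv]; ext z y; simp
  have hinl : (fderiv ℝ G (u, 0) ∘L .inl ℝ E (ℝ≥0 →ᵇ E)) = S := by
    rw [hGd.fderiv]; ext z y; simp
  have hinv : (fderiv ℝ G (u, 0) ∘L .inr ℝ E (ℝ≥0 →ᵇ E)).IsInvertible := by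
    rw [hinr]; exact ⟨ContinuousLinearEquiv.refl ℝ _, rfl⟩
  have hGat : ContDiffAt ℝ 1 G (u, 0) := hG.contDiffAt
  refine ⟨hGat.implicitFunction one_ne_zero hinv,
    hGat.implicitFunction_apply_self one_ne_zero hinv,
    hGat.contDiffAt_implicitFunction one_ne_zero hinv, fun j hj => ?_, ?_⟩
  -- The derivative of the implicit function at `u` is `-S`, and `S` has no growing component at
  -- time `0`.
  · have h1 := (hGat.hasStrictFDerivAt_implicitFunction one_ne_zero hinv).hasFDerivAt
    rw [hinl, hinr, ContinuousLinearMap.inverse_id] at h1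
    have h2 := (coordCLM b j).hasFDerivAt.comp u
      ((BoundedContinuousFunction.evalCLM ℝ (0 : ℝ≥0)).hasFDerivAt.comp u h1)
    refine h2.congr_fderiv ?_
    ext ξ
    simp [hS j hj]
  · filter_upwards [hGat.eventually_apply_eq_iff_implicitFunction one_ne_zero hinv] with z hz
    rw [← hz, hG0]
    have h1 : G z = 0 ↔ z.2 = S (u - z.1) + T (M z) := by
      simp only [G]
      rw [sub_sub, sub_eq_zero]
    rw [h1, hST]
    have h2 : ∀ y, 0 ≤ y → (A + η • ContinuousLinearMap.id ℝ E) (extendHalfLine z.2 y) +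
        extendHalfLine (M z) y =
        Q (z.1 + Real.exp (-η * y) • extendHalfLine z.2 y, z.1) (extendHalfLine z.2 y) +
            η • extendHalfLine z.2 y := by
      intro y hy
      lift y to ℝ≥0 using hy
      simp only [extendHalfLine_coe, M, P, BoundedContinuousFunction.sub_apply,
        pointwiseApply_apply, superposition_apply, weightedShift_apply,
        ContinuousLinearMap.compLeftContinuousBounded_apply, add_apply,
        smul_apply, ContinuousLinearMap.id_apply]
      abel
    refine and_congr_right fun _ => forall₂_congr fun y hy => ?_
    rw [h2 y hy]

end DiagonalSystem

/-! ### Exponential decay near a hyperbolic state. -/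

section HyperbolicDecay

variable {ι : Type*} [Fintype ι] {E : Type*} [NormedAddCommGroup E] [NormedSpace ℝ E]
  [FiniteDimensional ℝ E]

theorem exists_norm_sq_equiv_sum_sq (b : Module.Basis ι ℝ E) :
    ∃ K > 0, ∀ x : E, ‖x‖ ^ 2 ≤ K * ∑ j, coordCLM b j x ^ 2 ∧
      ∑ j, coordCLM b j x ^ 2 ≤ K * ‖x‖ ^ 2 := by
  refine ⟨∑ j, ‖b j‖ ^ 2 + ∑ j, ‖coordCLM b j‖ ^ 2 + 1, by positivity, fun x => ⟨?_, ?_⟩⟩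
  · have h1 : ‖x‖ ≤ ∑ j, |coordCLM b j x| * ‖b j‖ := by
      conv_lhs => rw [← sum_coordCLM_smul b x]
      refine (norm_sum_le _ _).trans (Finset.sum_le_sum fun j _ => ?_)
      rw [norm_smul, Real.norm_eq_abs]
    have h2 := Finset.sum_mul_sq_le_sq_mul_sq Finset.univ (fun j => |coordCLM b j x|)
      (fun j => ‖b j‖)
    simp only [sq_abs] at h2
    have h3 : 0 ≤ ∑ j, ‖coordCLM b j‖ ^ 2 := by positivity
    have h4 : 0 ≤ ∑ j, coordCLM b j x ^ 2 := by positivity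
    calc ‖x‖ ^ 2 ≤ (∑ j, |coordCLM b j x| * ‖b j‖) ^ 2 := by gcongr
      _ ≤ _ := h2
      _ ≤ _ := by nlinarith
  · have h1 : ∑ j, coordCLM b j x ^ 2 ≤ ∑ j, ‖coordCLM b j‖ ^ 2 * ‖x‖ ^ 2 := by
      refine Finset.sum_le_sum fun j _ => ?_
      rw [← mul_pow, ← sq_abs]
      gcongr
      exact (coordCLM b j).le_opNorm x
    rw [← Finset.sum_mul] at h1
    have h3 : 0 ≤ ∑ j, ‖b j‖ ^ 2 := by positivity
    nlinarith [sq_nonneg ‖x‖]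

/-- Trajectories that stay near a hyperbolic state and converge decay exponentially. -/
theorem exists_decay_of_hyperbolic (b : Module.Basis ι ℝ E) {μ : ι → ℝ} {m : ℝ} (hm : 0 < m)
    (hμ : ∀ j, m ≤ |μ j|) {Q : E × E → (E →L[ℝ] E)} {u : E} (hQ : ContinuousAt Q (u, u))
    (hQu : ∀ j, Q (u, u) (b j) = μ j • b j) :
    ∃ ρ > 0, ∃ C > 0, ∀ w ∈ Metric.ball u ρ, ∀ v : ℝ → E,
      (∀ y, 0 ≤ y → v y ∈ Metric.ball u ρ) →
      (∀ y, 0 ≤ y → HasDerivWithinAt v (Q (v y, w) (v y - w)) (Ici 0) y) →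
      Tendsto v atTop (𝓝 w) →
      ∀ y, 0 ≤ y → Real.exp (m / 2 * y) * ‖v y - w‖ ≤ C * ‖v 0 - w‖ := by
  obtain ⟨K, hK, hKx⟩ := exists_norm_sq_equiv_sum_sq b
  set A := Q (u, u) with hA
  obtain ⟨ρ, hρ, hρQ⟩ := Metric.continuousAt_iff.1 hQ (m / (4 * K)) (by positivity)
  refine ⟨ρ, hρ, 2 * K, by positivity, fun w hw v hv hder hlim => ?_⟩
  set z : ℝ → ι → ℝ := fun y j => coordCLM b j (v y - w) with hz
  set g : ℝ → ι → ℝ := fun y j => coordCLM b j ((Q (v y, w) - A) (v y - w)) with hg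
  have hzd : ∀ j y, 0 ≤ y →
      HasDerivWithinAt (fun y => z y j) (μ j * z y j + g y j) (Ici 0) y := by
    intro j y hy
    have h1 := (coordCLM b j).hasFDerivAt.comp_hasDerivWithinAt y ((hder y hy).sub_const w)
    refine h1.congr_deriv ?_
    rw [← coordCLM_diagonal hQu, ← map_add]
    simp
  -- The tolerance `m / (4 * K)` was chosen for this: two norm comparisons cost `K ^ 2` in the
  -- squares and leave the factor `(m / 4) ^ 2`. Young's inequality with weight `m / 4` then gives
  -- `m / 4 + m / 4`.
  have hgz : ∀ y, 0 ≤ y → ∑ j, 2 * |z y j * g y j| ≤ m / 2 * ∑ j, z y j ^ 2 := by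
    intro y hy
    have hQA : ‖Q (v y, w) - A‖ ≤ m / (4 * K) := by
      rw [← dist_eq_norm]
      refine (hρQ ?_).le
      rw [Prod.dist_eq]
      exact max_lt (hv y hy) hw
    have h1 : ∑ j, g y j ^ 2 ≤ (m / 4) ^ 2 * ∑ j, z y j ^ 2 := by
      calc ∑ j, g y j ^ 2 ≤ K * ‖(Q (v y, w) - A) (v y - w)‖ ^ 2 := (hKx _).2
        _ ≤ K * (m / (4 * K) * ‖v y - w‖) ^ 2 := by
          gcongr
          exact ContinuousLinearMap.le_of_opNorm_le _ hQA _
        _ = K * (m / (4 * K)) ^ 2 * ‖v y - w‖ ^ 2 := by ring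
        _ ≤ K * (m / (4 * K)) ^ 2 * (K * ∑ j, z y j ^ 2) := by
          gcongr
          exact (hKx _).1
        _ = _ := by field_simp
    have h2 : ∀ j, 2 * |z y j * g y j| ≤ m / 4 * z y j ^ 2 + (m / 4)⁻¹ * g y j ^ 2 := by
      intro j
      have h3 : (m / 4) * (m / 4)⁻¹ = 1 := mul_inv_cancel₀ (by positivity)
      have h4 : 0 < (m / 4)⁻¹ := by positivity
      rw [abs_mul, ← sq_abs (z y j), ← sq_abs (g y j)]
      have h5 := mul_nonneg h4.le (sq_nonneg (m / 4 * |z y j| - |g y j|))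
      have h6 : (m / 4)⁻¹ * (m / 4 * |z y j| - |g y j|) ^ 2 =
          m / 4 * |z y j| ^ 2 + (m / 4)⁻¹ * |g y j| ^ 2 - 2 * (|z y j| * |g y j|) := by
        linear_combination (m / 4 * |z y j| ^ 2 - 2 * |z y j| * |g y j|) * h3
      linarith
    calc ∑ j, 2 * |z y j * g y j|
        ≤ ∑ j, (m / 4 * z y j ^ 2 + (m / 4)⁻¹ * g y j ^ 2) := Finset.sum_le_sum fun j _ => h2 j
      _ = m / 4 * ∑ j, z y j ^ 2 + (m / 4)⁻¹ * ∑ j, g y j ^ 2 := by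
        rw [Finset.sum_add_distrib, Finset.mul_sum, Finset.mul_sum]
      _ ≤ m / 4 * ∑ j, z y j ^ 2 + (m / 4)⁻¹ * ((m / 4) ^ 2 * ∑ j, z y j ^ 2) := by gcongr
      _ = _ := by field_simp; ring
  have hsq : ∀ (c : ι → ℝ) y, 0 ≤ y → HasDerivWithinAt (fun y => ∑ j, c j * z y j ^ 2)
      (∑ j, c j * (2 * z y j * (μ j * z y j + g y j))) (Ici 0) y := by
    intro c y hy
    refine HasDerivWithinAt.fun_sum fun j _ => ?_
    simpa using ((hzd j y hy).pow 2).const_mul (c j)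
  have hint : ∀ {f f' : ℝ → ℝ}, (∀ y, 0 ≤ y → HasDerivWithinAt f (f' y) (Ici 0) y) →
      (∀ y, 0 ≤ y → f' y ≤ 0) → AntitoneOn f (Ici 0) := by
    intro f f' hf hf'
    refine antitoneOn_of_hasDerivWithinAt_nonpos (convex_Ici 0)
      (fun y hy => (hf y hy).continuousWithinAt)
      (fun y hy => (hf y (interior_subset hy)).mono interior_subset)
      (fun y hy => hf' y (interior_subset hy))
  -- the unstable part never exceeds the stable one
  set σ : ι → ℝ := fun j => if μ j < 0 then 1 else -1 with hσ
  have hσμ : ∀ j, σ j * μ j ≤ -m := by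
    intro j
    have := hμ j
    by_cases h : μ j < 0
    · simp only [hσ, if_pos h, one_mul]; rw [abs_of_neg h] at this; linarith
    · simp only [hσ, if_neg h]; rw [abs_of_nonneg (not_lt.1 h)] at this; linarith
  have hσabs : ∀ j x, σ j * x ≤ |x| := by
    intro j x
    by_cases h : μ j < 0
    · simpa [hσ, h] using le_abs_self x
    · simpa [hσ, h] using neg_le_abs x
  -- The derivative is at most `(-2m + m/2) ∑ z²`. Being nonincreasing with limit `0`, the
  -- difference of the stable and unstable parts is nonnegative.
  have hDanti : AntitoneOn (fun y => ∑ j, σ j * z y j ^ 2) (Ici 0) := by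
    refine hint (hsq σ) fun y hy => ?_
    have h1 : ∑ j, σ j * (2 * z y j * (μ j * z y j + g y j)) ≤
        ∑ j, (-(2 * m) * z y j ^ 2 + 2 * |z y j * g y j|) := by
      refine Finset.sum_le_sum fun j _ => ?_
      have h2 := mul_le_mul_of_nonneg_right (hσμ j) (sq_nonneg (z y j))
      have h3 := hσabs j (z y j * g y j)
      nlinarith
    rw [Finset.sum_add_distrib, ← Finset.mul_sum] at h1
    have h4 := hgz y hy
    have h5 : 0 ≤ ∑ j, z y j ^ 2 := by positivity
    nlinarith
  have hzlim : ∀ j, Tendsto (fun y => z y j) atTop (𝓝 0) := by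
    intro j
    have := ((coordCLM b j).continuous.tendsto _).comp (hlim.sub_const w)
    simpa using! this
  have hDlim : Tendsto (fun y => ∑ j, σ j * z y j ^ 2) atTop (𝓝 0) := by
    have := tendsto_finsetSum Finset.univ (fun j _ => ((hzlim j).pow 2).const_mul (σ j))
    simpa using this
  have hDnonneg : ∀ y, 0 ≤ y → 0 ≤ ∑ j, σ j * z y j ^ 2 := by
    intro y hy
    refine le_of_tendsto hDlim ?_
    filter_upwards [eventually_ge_atTop y] with t ht
    exact hDanti hy (hy.trans ht) ht
  -- the stable part decays
  set χ : ι → ℝ := fun j => if μ j < 0 then 1 else 0 with hχ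
  have hχσ : ∀ j, χ j = (1 + σ j) / 2 := by
    intro j
    by_cases h : μ j < 0 <;> simp [hχ, hσ, h]
  have hχsum : ∀ y, ∑ j, χ j * z y j ^ 2 =
      (∑ j, z y j ^ 2 + ∑ j, σ j * z y j ^ 2) / 2 := by
    intro y
    rw [← Finset.sum_add_distrib, Finset.sum_div]
    exact Finset.sum_congr rfl fun j _ => by rw [hχσ]; ring
  have hχμ : ∀ j, χ j * μ j ≤ -m * χ j := by
    intro j
    have := hμ j
    by_cases h : μ j < 0
    · simp only [hχ, if_pos h, one_mul]; rw [abs_of_neg h] at this; linarith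
    · simp [hχ, h]
  have hχabs : ∀ j x, χ j * x ≤ |x| := by
    intro j x
    by_cases h : μ j < 0
    · simpa [hχ, h] using le_abs_self x
    · simp [hχ, h]
  -- For the stable part `X`, the derivative is at most `-2m X + (m/2) ∑ z²`, and `∑ z² ≤ 2 X`
  -- because the unstable part is dominated. Thus `X' ≤ -m X`, and the norm decays at rate `m / 2`.
  have hXanti : AntitoneOn (fun y => Real.exp (m * y) * ∑ j, χ j * z y j ^ 2) (Ici 0) := by
    have hexp : ∀ y : ℝ, HasDerivAt (fun y => Real.exp (m * y)) (Real.exp (m * y) * m) y := by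
      intro y
      simpa using ((hasDerivAt_id y).const_mul m).exp
    refine hint (fun y hy => (hexp y).hasDerivWithinAt.mul (hsq χ y hy)) fun y hy => ?_
    have h1 : ∑ j, χ j * (2 * z y j * (μ j * z y j + g y j)) ≤
        ∑ j, (-(2 * m) * (χ j * z y j ^ 2) + 2 * |z y j * g y j|) := by
      refine Finset.sum_le_sum fun j _ => ?_
      have h2 := mul_le_mul_of_nonneg_right (hχμ j) (sq_nonneg (z y j))
      have h3 := hχabs j (z y j * g y j)
      nlinarith
    rw [Finset.sum_add_distrib, ← Finset.mul_sum] at h1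
    have h4 := hgz y hy
    have h5 := hDnonneg y hy
    have h6 := hχsum y
    have h7 : m * ∑ j, χ j * z y j ^ 2 +
        ∑ j, χ j * (2 * z y j * (μ j * z y j + g y j)) ≤ 0 := by
      nlinarith
    have h8 := mul_nonpos_of_nonneg_of_nonpos (Real.exp_pos (m * y)).le h7
    linarith
  intro y hy
  have h1 := hXanti (mem_Ici.2 le_rfl) hy hy
  simp only [mul_zero, Real.exp_zero, one_mul] at h1
  have h2 : ‖v y - w‖ ^ 2 ≤ K * (2 * ∑ j, χ j * z y j ^ 2) := by
    refine (hKx _).1.trans ?_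
    gcongr
    have := hDnonneg y hy
    have := hχsum y
    linarith
  have h3 : ∑ j, χ j * z 0 j ^ 2 ≤ K * ‖v 0 - w‖ ^ 2 := by
    refine le_trans (Finset.sum_le_sum fun j _ => ?_) (hKx _).2
    exact (hχabs j _).trans (by rw [abs_of_nonneg (sq_nonneg _)])
  have hexp : Real.exp (m / 2 * y) ^ 2 = Real.exp (m * y) := by
    rw [← Real.exp_nat_mul]; congr 1; push_cast; ring
  refine (pow_le_pow_iff_left₀ (by positivity) (by positivity) two_ne_zero).1 ?_
  calc (Real.exp (m / 2 * y) * ‖v y - w‖) ^ 2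
      = Real.exp (m * y) * ‖v y - w‖ ^ 2 := by rw [mul_pow, hexp]
    _ ≤ Real.exp (m * y) * (K * (2 * ∑ j, χ j * z y j ^ 2)) := by gcongr
    _ = 2 * K * (Real.exp (m * y) * ∑ j, χ j * z y j ^ 2) := by ring
    _ ≤ 2 * K * (K * ‖v 0 - w‖ ^ 2) := mul_le_mul_of_nonneg_left (h1.trans h3) (by positivity)
    _ ≤ (2 * K * ‖v 0 - w‖) ^ 2 := by nlinarith [mul_nonneg (sq_nonneg K) (sq_nonneg ‖v 0 - w‖)]

end HyperbolicDecay

/-! ### Straightening the set of limit states. -/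

section Profiles

variable {ι : Type*} {E : Type*} [NormedAddCommGroup E] [NormedSpace ℝ E]

/-- `v` solves `v' = Q(v, w) (v - w)` on the half line, starts at `u` and converges to `w`. -/
structure IsProfile (Q : E × E → (E →L[ℝ] E)) (u w : E) (v : ℝ → E) : Prop where
  hasDerivWithinAt : ∀ y, 0 ≤ y → HasDerivWithinAt v (Q (v y, w) (v y - w)) (Ici 0) y
  initial : v 0 = u
  tendsto : Tendsto v atTop (𝓝 w)

theorem hasDerivWithinAt_exp_mul (c : ℝ) (s : Set ℝ) (y : ℝ) :
    HasDerivWithinAt (fun y => Real.exp (c * y)) (Real.exp (c * y) * c) s y := by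
  simpa using (((hasDerivAt_id y).const_mul c).exp).hasDerivWithinAt

variable [FiniteDimensional ℝ E]

theorem mem_span_image_iff_coordCLM (b : Module.Basis ι ℝ E) (s : Set ι) (x : E) :
    x ∈ Submodule.span ℝ (b '' s) ↔ ∀ j, j ∉ s → coordCLM b j x = 0 := by
  rw [b.mem_span_image]
  constructor
  · intro h j hj
    by_contra hne
    exact hj (h (by simpa [coordCLM] using! hne))
  · intro h j hj
    by_contra hne
    simp only [Finset.mem_coe, Finsupp.mem_support_iff] at hj
    exact hj (h j hne)

variable [Fintype ι]

/-- The limit states of the profiles that start at `u` are, near `u`, straightened by a `C¹` map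
`θ` to the stable subspace of the linearization at `u`; this concerns the exponentially decaying
profiles in general and all profiles near `u` in the hyperbolic case. -/
theorem exists_straightening (b : Module.Basis ι ℝ E) {μ : ι → ℝ} {m : ℝ} (hm : 0 < m)
    (hμ : ∀ j, μ j ≤ -m ∨ 0 ≤ μ j) {Q : E × E → (E →L[ℝ] E)} (hQ : ContDiff ℝ 1 Q) {u : E}
    (hQu : ∀ j, Q (u, u) (b j) = μ j • b j) :
    ∃ θ : E → E, ContDiffAt ℝ 1 θ u ∧ HasFDerivAt θ (ContinuousLinearMap.id ℝ E) u ∧ θ u = 0 ∧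
      (∀ r > 0, ∀ᶠ w in 𝓝 u, θ w ∈ Submodule.span ℝ (b '' {j | μ j < 0}) →
        ∃ v, IsProfile Q u w v ∧ ∀ y, 0 ≤ y → v y ∈ Metric.ball u r) ∧
      ((∀ j, m ≤ |μ j|) → ∃ ρ > 0, ∀ᶠ w in 𝓝 u, ∀ v, IsProfile Q u w v →
        (∀ y, 0 ≤ y → v y ∈ Metric.ball u ρ) →
          θ w ∈ Submodule.span ℝ (b '' {j | μ j < 0})) := by
  classical
  -- The shift `m / 2` carries no negative eigenvalue across zero and makes a zero eigenvalue
  -- positive, so slow directions count as growing.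
  have hstable : ∀ j, μ j + m / 2 < 0 ↔ μ j < 0 := fun j => by
    rcases hμ j with h | h <;> constructor <;> intro h' <;> linarith
  have hunstable : ∀ j, ¬ μ j < 0 → 0 < μ j + m / 2 := fun j h => by linarith [not_lt.1 h]
  obtain ⟨Z, hZu, hZ, hZd, hZiff⟩ := exists_weightedProfile b (η := m / 2) (by positivity)
    (fun j => by rcases hμ j with h | h; exacts [by linarith, by linarith]) hQ hQu
  -- The stable coordinates of `θ w` are those of `w - u`; the others measure the mismatch between
  -- `Z w 0` and `u - w`.
  let θ : E → E := fun w =>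
    w - u + ∑ j, (if μ j < 0 then 0 else coordCLM b j (Z w 0)) • b j
  have hθcoord : ∀ w j, ¬ μ j < 0 →
      coordCLM b j (θ w) = coordCLM b j (Z w 0) - coordCLM b j (u - w) := by
    intro w j hj
    rw [map_add, coordCLM_sum_smul, if_neg hj, map_sub, map_sub]
    ring
  have heval : ContDiff ℝ 1 (BoundedContinuousFunction.evalCLM (β := E) ℝ (0 : ℝ≥0)) :=
    ContinuousLinearMap.contDiff _
  have hZ0 : ContDiffAt ℝ 1 (fun w => Z w 0) u := heval.contDiffAt.comp u hZ
  have hmem : ∀ w, θ w ∈ Submodule.span ℝ (b '' {j | μ j < 0}) ↔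
      ∀ j, ¬ μ j < 0 → coordCLM b j (Z w 0) = coordCLM b j (u - w) := by
    intro w
    rw [mem_span_image_iff_coordCLM]
    refine forall₂_congr fun j hj => ?_
    rw [hθcoord w j hj, sub_eq_zero]
  have hpair : Tendsto (fun w => (w, Z w)) (𝓝 u) (𝓝 (u, 0)) := by
    have := (continuousAt_id (x := u)).prodMk hZ.continuousAt
    rw [ContinuousAt, hZu] at this
    exact this
  refine ⟨θ, ?_, ?_, ?_, fun r hr => ?_, fun hhyp => ?_⟩
  · refine (contDiffAt_id.sub contDiffAt_const).add (ContDiffAt.sum fun j _ => ?_)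
    split_ifs
    · exact contDiffAt_const
    · exact ((coordCLM b j).contDiff.contDiffAt.comp u hZ0).smul contDiffAt_const
  · have h1 : HasFDerivAt (fun w => ∑ j, (if μ j < 0 then 0 else coordCLM b j (Z w 0)) • b j)
        (∑ j : ι, (0 : E →L[ℝ] E)) u := by
      refine HasFDerivAt.fun_sum fun j _ => ?_
      split_ifs with hj
      · exact hasFDerivAt_const _ _
      · simpa using (hZd j (hunstable j hj)).smul_const (b j)
    refine (((hasFDerivAt_id u).sub_const u).add h1).congr_fderiv ?_
    simp
  · simp [θ, hZu]
  · have hball : ∀ᶠ w in 𝓝 u, ‖w - u‖ + ‖Z w‖ < r := by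
      have : Tendsto (fun w => ‖w - u‖ + ‖Z w‖) (𝓝 u) (𝓝 (‖u - u‖ + ‖Z u‖)) :=
        ((continuousAt_id.sub continuousAt_const).norm).add hZ.continuousAt.norm
      rw [hZu] at this
      simp only [sub_self, norm_zero, add_zero] at this
      exact this.eventually_lt_const hr
    filter_upwards [hpair.eventually hZiff, hball] with w hw hwr hθ
    obtain ⟨hs, hode⟩ := hw.1 rfl
    set ζ := Z w with hζ
    have h0 : ζ 0 = u - w := by
      refine ext_coordCLM b fun j => ?_
      by_cases hj : μ j < 0
      · exact hs j ((hstable j).2 hj)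
      · exact (hmem w).1 hθ j hj
    refine ⟨fun y => w + Real.exp (-(m / 2) * y) • extendHalfLine ζ y,
      ⟨fun y hy => ?_, ?_, ?_⟩, fun y hy => ?_⟩
    · have h1 := ((hasDerivWithinAt_exp_mul (-(m / 2)) (Ici 0) y).smul (hode y hy)).const_add w
      refine h1.congr_deriv ?_
      rw [add_sub_cancel_left, map_smul]
      module
    · simp [extendHalfLine_zero, h0]
    · have he : Tendsto (fun y : ℝ => Real.exp (-(m / 2) * y)) atTop (𝓝 0) :=
        Real.tendsto_exp_atBot.comp
          (tendsto_id.const_mul_atTop_of_neg (neg_lt_zero.2 (half_pos hm)))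
      have hbd : IsBoundedUnder (· ≤ ·) atTop (norm ∘ extendHalfLine ζ) :=
        isBoundedUnder_of ⟨‖ζ‖, norm_extendHalfLine_le ζ⟩
      simpa using (NormedField.tendsto_zero_smul_of_tendsto_zero_of_bounded he hbd).const_add w
    · rw [Metric.mem_ball, dist_eq_norm, add_sub_right_comm]
      refine lt_of_le_of_lt ((norm_add_le _ _).trans ?_) hwr
      gcongr
      rw [norm_smul, Real.norm_of_nonneg (Real.exp_pos _).le]
      have h1 : Real.exp (-(m / 2) * y) ≤ 1 :=
        Real.exp_le_one_iff.2 (by nlinarith)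
      calc _ ≤ 1 * ‖ζ‖ := mul_le_mul h1 (norm_extendHalfLine_le ζ y) (norm_nonneg _) zero_le_one
        _ = _ := one_mul _
  · obtain ⟨ρ, hρ, C, hC, hdecay⟩ :=
      exists_decay_of_hyperbolic b hm hhyp hQ.continuous.continuousAt hQu
    refine ⟨ρ, hρ, ?_⟩
    obtain ⟨ε, hε, hball⟩ := Metric.eventually_nhds_iff_ball.1 hZiff
    have hnear : ∀ᶠ w in 𝓝 u, C * ‖u - w‖ < ε := by
      have : Tendsto (fun w => C * ‖u - w‖) (𝓝 u) (𝓝 (C * ‖u - u‖)) :=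
        (continuousAt_const.sub continuousAt_id).norm.const_mul C
      simp only [sub_self, norm_zero, mul_zero] at this
      exact this.eventually_lt_const hε
    filter_upwards [hnear, Metric.ball_mem_nhds u hρ, Metric.ball_mem_nhds u hε]
      with w hwC hwρ hwε v hv hvρ
    have hbd := hdecay w hwρ v hvρ hv.hasDerivWithinAt hv.tendsto
    rw [hv.initial] at hbd
    have hcont : ContinuousOn v (Ici 0) := fun y hy =>
      (hv.hasDerivWithinAt y hy).continuousWithinAt
    -- The decay estimate makes the rescaled profile bounded, with norm at most `C * ‖u - w‖`. For
    -- `w` near `u` it therefore lies where `Z` is characterized, which forces `ζ = Z w`.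
    let ζ : ℝ≥0 →ᵇ E := BoundedContinuousFunction.ofNormedAddCommGroup
      (fun y : ℝ≥0 => Real.exp (m / 2 * y) • (v y - w))
      ((by fun_prop : Continuous fun y : ℝ≥0 => Real.exp (m / 2 * y)).smul
        ((hcont.comp_continuous NNReal.continuous_coe fun y => y.2).sub continuous_const))
      (C * ‖u - w‖) (fun y => by
        rw [norm_smul, Real.norm_of_nonneg (Real.exp_pos _).le]
        exact hbd y y.2)
    have hζ : ∀ y, 0 ≤ y → extendHalfLine ζ y = Real.exp (m / 2 * y) • (v y - w) := by
      intro y hy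
      lift y to ℝ≥0 using hy
      rw [extendHalfLine_coe]
      rfl
    have hζnorm : ‖ζ‖ ≤ C * ‖u - w‖ :=
      BoundedContinuousFunction.norm_ofNormedAddCommGroup_le _ (by positivity) _
    have hζ0 : ζ 0 = u - w := by
      rw [← extendHalfLine_zero, hζ 0 le_rfl, hv.initial]
      simp
    have hmemball : (w, ζ) ∈ Metric.ball (u, (0 : ℝ≥0 →ᵇ E)) ε := by
      rw [Metric.mem_ball, Prod.dist_eq]
      exact max_lt hwε (by rw [dist_zero_right]; exact hζnorm.trans_lt hwC)
    have hZw : Z w = ζ := by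
      refine (hball (w, ζ) hmemball).2 ⟨fun j _ => by rw [hζ0], fun y hy => ?_⟩
      have h1 := (hasDerivWithinAt_exp_mul (m / 2) (Ici 0) y).smul
        ((hv.hasDerivWithinAt y hy).sub_const w)
      have h2 : w + Real.exp (-(m / 2) * y) • extendHalfLine ζ y = v y := by
        rw [hζ y hy, smul_smul, ← Real.exp_add]
        simp
      refine HasDerivWithinAt.congr_deriv (h1.congr (fun t ht => hζ t ht) (hζ y hy)) ?_
      simp only
      rw [h2, hζ y hy, map_smul]
      module
    refine (hmem w).2 fun j _ => ?_
    rw [hZw, hζ0]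

end Profiles

/-! ### From a straightening map to a submanifold. -/

section Submanifold

variable {N : ℕ}

theorem mem_submodule_of_hasDerivAt {E : Type*} [NormedAddCommGroup E] [NormedSpace ℝ E]
    [FiniteDimensional ℝ E] {L : Submodule ℝ E} {g : ℝ → E} {g' : E} {t : ℝ}
    (hg : HasDerivAt g g' t) (hL : ∀ᶠ s in 𝓝 t, g s ∈ L) : g' ∈ L := by
  refine L.closed_of_finiteDimensional.mem_of_tendsto (hasDerivAt_iff_tendsto_slope.1 hg) ?_
  filter_upwards [hL.filter_mono nhdsWithin_le_nhds] with s hs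
  exact L.smul_mem _ (L.sub_mem hs hL.self_of_nhds)

/-- A set that a `C¹` map with identity derivative at `x` straightens to `L` near `x` is there a
submanifold with tangent space `L`. -/
theorem isLocallySubmanifoldAt_of_straightening {p : ℕ} {S : Set (EuclideanSpace ℝ (Fin N))}
    {x : EuclideanSpace ℝ (Fin N)} {L : Submodule ℝ (EuclideanSpace ℝ (Fin N))}
    (hp : Module.finrank ℝ L = p) {θ : EuclideanSpace ℝ (Fin N) → EuclideanSpace ℝ (Fin N)}
    (hθ : ContDiffAt ℝ 1 θ x) (hθ' : HasFDerivAt θ (ContinuousLinearMap.id ℝ _) x)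
    (hθx : θ x = 0) (hS : ∀ᶠ w in 𝓝 x, w ∈ S ↔ θ w ∈ L) :
    IsLocallySubmanifoldAt p S x L := by
  have hθe : HasFDerivAt θ ((ContinuousLinearEquiv.refl ℝ (EuclideanSpace ℝ (Fin N)) :
      EuclideanSpace ℝ (Fin N) ≃L[ℝ] EuclideanSpace ℝ (Fin N)) :
      EuclideanSpace ℝ (Fin N) →L[ℝ] EuclideanSpace ℝ (Fin N)) x := hθ'
  set Φ₀ := hθ.toOpenPartialHomeomorph θ hθe one_ne_zero with hΦ₀
  have hcoe : ∀ z, Φ₀ z = θ z := fun _ => rfl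
  have hx₀ : x ∈ Φ₀.source := hθ.mem_toOpenPartialHomeomorph_source hθe one_ne_zero
  have hsymmx : ContDiffAt ℝ 1 Φ₀.symm (θ x) := hθ.to_localInverse hθe one_ne_zero
  have hev : ∀ᶠ w in 𝓝 x, ContDiffAt ℝ 1 θ w ∧ ContDiffAt ℝ 1 Φ₀.symm (θ w) ∧
      (w ∈ S ↔ θ w ∈ L) :=
    (hθ.eventually (by simp)).and ((hθ.continuousAt.eventually
      (hsymmx.eventually (by simp))).and hS)
  obtain ⟨O, hO, hOopen, hxO⟩ := eventually_nhds_iff.1 hev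
  -- Smoothness of `θ` and of its local inverse, and the description of `S`, are known only near
  -- `x`; on `O` all three hold at every point.
  set Φ := Φ₀.restrOpen O hOopen with hΦ
  have hsource : Φ.source = Φ₀.source ∩ O := Φ₀.restrOpen_source O hOopen
  have hsub : ∀ z ∈ Φ.source, z ∈ O := fun z hz => (hsource ▸ hz).2
  have hxΦ : x ∈ Φ.source := hsource ▸ ⟨hx₀, hxO⟩
  have hΦθ : ∀ z, Φ z = θ z := fun _ => rfl
  have hsymm : ∀ z ∈ Φ.target, ContDiffAt ℝ 1 Φ.symm z := by
    intro z hz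
    have h1 := (hO _ (hsub _ (Φ.map_target hz))).2.1
    rw [← hΦθ, Φ.right_inv hz] at h1
    exact h1
  have hiff : ∀ z ∈ Φ.source, z ∈ S ∩ Φ.source ↔ Φ z ∈ L := fun z hz =>
    ⟨fun h => (hO z (hsub z hz)).2.2.1 h.1, fun h => ⟨(hO z (hsub z hz)).2.2.2 h, hz⟩⟩
  have h0t : (0 : EuclideanSpace ℝ (Fin N)) ∈ Φ.target := by
    rw [← hθx, ← hΦθ]; exact Φ.map_source hxΦ
  have hsymm0 : Φ.symm 0 = x := by
    rw [← hθx, ← hΦθ]; exact Φ.left_inv hxΦ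
  refine ⟨Φ.source, Φ.open_source, hxΦ, ?_, ?_, ?_⟩
  · exact ((hiff x hxΦ).2 (by rw [hΦθ, hθx]; exact L.zero_mem)).1
  · intro y hy
    exact ⟨Φ, L, hy.2, fun z hz => (hO z (hsub z hz)).1.contDiffWithinAt,
      fun z hz => (hsymm z hz).contDiffWithinAt, hp, hiff⟩
  -- Since `θ` has identity derivative at `x`, a curve in the set has the same velocity as its image
  -- in `L`. Conversely `t ↦ Φ.symm (t • h)` realizes each `h ∈ L`.
  · ext h
    constructor
    · rintro ⟨γ, hγ, hγ0, hγ', hmem⟩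
      have h1 : HasDerivAt γ h 0 := hγ' ▸ (hγ.differentiableAt one_ne_zero).hasDerivAt
      have h2 : HasDerivAt (fun t => θ (γ t)) h 0 :=
        HasFDerivAt.comp_hasDerivAt (l := θ) (l' := ContinuousLinearMap.id ℝ _) 0 (hγ0.symm ▸ hθ') h1
      refine mem_submodule_of_hasDerivAt h2 ?_
      filter_upwards [hmem] with t ht
      exact (hiff _ ht.2).1 ht
    · intro hh
      have hline : HasDerivAt (fun t : ℝ => t • h) h 0 := by
        simpa using (hasDerivAt_id (0 : ℝ)).smul_const h
      have hΦd : HasFDerivAt Φ.symm ((ContinuousLinearEquiv.refl ℝ (EuclideanSpace ℝ (Fin N))).symm :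
          EuclideanSpace ℝ (Fin N) →L[ℝ] EuclideanSpace ℝ (Fin N)) 0 :=
        Φ.hasFDerivAt_symm h0t (by rw [hsymm0]; exact hθe)
      have h1 : HasDerivAt (fun t : ℝ => Φ.symm (t • h)) h 0 :=
        HasFDerivAt.comp_hasDerivAt (l := Φ.symm) (l' := ContinuousLinearMap.id ℝ _) 0
          (by rw [zero_smul]; exact hΦd) hline
      refine ⟨fun t => Φ.symm (t • h), ?_, by simp [hsymm0], h1.deriv, ?_⟩
      · refine ContDiffAt.comp (0 : ℝ) (g := Φ.symm) ?_ (by fun_prop)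
        rw [zero_smul]
        exact hsymm 0 h0t
      · have hcont : Tendsto (fun t : ℝ => t • h) (𝓝 0) (𝓝 0) := by
          simpa using hline.continuousAt.tendsto
        filter_upwards [hcont.eventually (Φ.open_target.mem_nhds h0t)] with t ht
        refine (hiff _ (Φ.map_target ht)).2 ?_
        rw [Φ.right_inv ht]
        exact L.smul_mem t hh

end Submanifold

/-! ### Confinement of profiles by entropy dissipation. -/

section EntropyConfinement

/-- A strictly differentiable map with injective derivative expands distances near the point up to
a constant. -/
theorem HasStrictFDerivAt.exists_le_norm_image_sub {E : Type*} [NormedAddCommGroup E]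
    [NormedSpace ℝ E] [FiniteDimensional ℝ E] {F : Type*} [NormedAddCommGroup F] [NormedSpace ℝ F]
    {f : E → F} {f' : E →L[ℝ] F} {x : E} (hf : HasStrictFDerivAt f f' x)
    (hinj : Function.Injective f') :
    ∃ k > 0, ∃ r > 0, ∀ v ∈ Metric.ball x r, ∀ w ∈ Metric.ball x r,
      k * ‖v - w‖ ≤ ‖f v - f w‖ := by
  obtain ⟨K, hK, hanti⟩ := (f' : E →ₗ[ℝ] F).exists_antilipschitzWith (LinearMap.ker_eq_bot.2 hinj)
  have hK' : (0 : ℝ) < K := hK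
  have hev := (Asymptotics.isLittleO_iff.1 hf.isLittleO) (c := (2 * (K : ℝ))⁻¹) (by positivity)
  obtain ⟨r, hr, hball⟩ := Metric.eventually_nhds_iff_ball.1 hev
  refine ⟨(2 * (K : ℝ))⁻¹, by positivity, r, hr, fun v hv w hw => ?_⟩
  have h1 := hball (v, w) (by rw [← ball_prod_same]; exact ⟨hv, hw⟩)
  have h2 : ‖v - w‖ ≤ K * ‖f' (v - w)‖ := by
    have := hanti.le_mul_dist v w
    simpa [dist_eq_norm] using this
  have h3 : (K : ℝ)⁻¹ * ‖v - w‖ ≤ ‖f' (v - w)‖ := by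
    rw [inv_mul_le_iff₀ hK']; exact h2
  have h4 : ‖f' (v - w)‖ ≤ ‖f v - f w‖ + ‖f v - f w - f' (v - w)‖ := by
    have := norm_sub_le (f v - f w) (f v - f w - f' (v - w))
    simpa using this
  have h5 : (2 * (K : ℝ))⁻¹ = (K : ℝ)⁻¹ / 2 := by field_simp
  rw [h5] at h1 ⊢
  simp only at h1
  linarith

variable {N : ℕ} {𝒰 : Set (EuclideanSpace ℝ (Fin N))}
  {f : EuclideanSpace ℝ (Fin N) → EuclideanSpace ℝ (Fin N)}
  {B : EuclideanSpace ℝ (Fin N) → EuclideanSpace ℝ (Fin N) →L[ℝ] EuclideanSpace ℝ (Fin N)}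
  {U F : EuclideanSpace ℝ (Fin N) → ℝ}

/-- The entropy excess of the state `v` over the limit state `w`; it dissipates along profiles. -/
noncomputable def entropyExcess (f : EuclideanSpace ℝ (Fin N) → EuclideanSpace ℝ (Fin N))
    (U F : EuclideanSpace ℝ (Fin N) → ℝ) (w v : EuclideanSpace ℝ (Fin N)) : ℝ :=
  F v - F w - fderiv ℝ U v (f v - f w)

/-- The terms `∇F v'` and `∇U ∇f v'` cancel by compatibility. What remains comes from
differentiating `∇U`, and there the layer equation replaces `f(v) - f(w)` by `B(v) v'`. -/
theorem IsBConvexEntropyPair.hasDerivWithinAt_entropyExcess (h𝒰 : IsOpen 𝒰)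
    (hf : ContDiffOn ℝ 1 f 𝒰) (hUF : IsBConvexEntropyPair 𝒰 f B U F)
    {w d : EuclideanSpace ℝ (Fin N)} {v : ℝ → EuclideanSpace ℝ (Fin N)} {s : Set ℝ} {y : ℝ}
    (hv : HasDerivWithinAt v d s y) (hvy : v y ∈ 𝒰) (hode : B (v y) d = f (v y) - f w) :
    HasDerivWithinAt (fun y => entropyExcess f U F w (v y))
      (-fderiv ℝ (fderiv ℝ U) (v y) d (B (v y) d)) s y := by
  obtain ⟨hU, hF, hcomp, -⟩ := hUF
  have hn := h𝒰.mem_nhds hvy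
  have hfd := ((hf.contDiffAt hn).differentiableAt one_ne_zero).hasFDerivAt.comp_hasDerivWithinAt
    y hv
  have hFd := ((hF.contDiffAt hn).differentiableAt two_ne_zero).hasFDerivAt.comp_hasDerivWithinAt
    y hv
  have hUd := (((hU.contDiffAt hn).fderiv_right (m := 1)
    (by norm_num [one_add_one_eq_two])).differentiableAt
      one_ne_zero).hasFDerivAt.comp_hasDerivWithinAt y hv
  have h1 := (hFd.sub_const (F w)).sub (hUd.clm_apply (hfd.sub_const (f w)))
  refine h1.congr_deriv ?_
  rw [hcomp _ hvy, hode]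
  simp

theorem IsBConvexEntropyPair.continuousAt_entropyExcess (h𝒰 : IsOpen 𝒰)
    (hf : ContDiffOn ℝ 1 f 𝒰) (hUF : IsBConvexEntropyPair 𝒰 f B U F)
    {z : EuclideanSpace ℝ (Fin N) × EuclideanSpace ℝ (Fin N)} (h1 : z.1 ∈ 𝒰) (h2 : z.2 ∈ 𝒰) :
    ContinuousAt (fun z : EuclideanSpace ℝ (Fin N) × EuclideanSpace ℝ (Fin N) =>
      entropyExcess f U F z.1 z.2) z := by
  obtain ⟨hU, hF, -, -⟩ := hUF
  have hfc := fun x hx => (hf.contDiffAt (h𝒰.mem_nhds (x := x) hx)).continuousAt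
  have hFc := fun x hx => (hF.contDiffAt (h𝒰.mem_nhds (x := x) hx)).continuousAt
  have hUc := ((hU.contDiffAt (h𝒰.mem_nhds h2)).fderiv_right (m := 1)
    (by norm_num [one_add_one_eq_two])).continuousAt
  have e1 := continuousAt_fst (p := z)
  have e2 := continuousAt_snd (p := z)
  exact (((hFc _ h2).comp e2).sub ((hFc _ h1).comp e1)).sub
    (ContinuousAt.clm_apply (hUc.comp e2) (((hfc _ h2).comp e2).sub ((hfc _ h1).comp e1)))

theorem IsBConvexEntropyPair.dissipation_nonneg (hUF : IsBConvexEntropyPair 𝒰 f B U F)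
    {u : EuclideanSpace ℝ (Fin N)} (hu : u ∈ 𝒰) (h : EuclideanSpace ℝ (Fin N)) :
    0 ≤ fderiv ℝ (fderiv ℝ U) u h (B u h) := by
  rcases eq_or_ne h 0 with rfl | hne
  · simp
  · exact (hUF.2.2.2 u hu h hne).le

/-- Positivity is uniform on the compact product of `K` with the unit sphere; quadratic homogeneity
does the rest. -/
theorem IsBConvexEntropyPair.exists_coercive (h𝒰 : IsOpen 𝒰) (hB : ContinuousOn B 𝒰)
    (hUF : IsBConvexEntropyPair 𝒰 f B U F) {K : Set (EuclideanSpace ℝ (Fin N))}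
    (hK : IsCompact K) (hK𝒰 : K ⊆ 𝒰) :
    ∃ c > 0, ∀ u ∈ K, ∀ h, c * ‖h‖ ^ 2 ≤ fderiv ℝ (fderiv ℝ U) u h (B u h) := by
  have hUc : ContinuousOn (fderiv ℝ (fderiv ℝ U)) 𝒰 := by
    have h1 : ContDiffOn ℝ 1 (fderiv ℝ U) 𝒰 :=
      hUF.1.fderiv_of_isOpen h𝒰 (by norm_num [one_add_one_eq_two])
    exact (h1.fderiv_of_isOpen (m := 0) h𝒰 (by norm_num)).continuousOn
  have hmaps : MapsTo Prod.fst (K ×ˢ Metric.sphere (0 : EuclideanSpace ℝ (Fin N)) 1) 𝒰 :=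
    fun z hz => hK𝒰 hz.1
  have hcont : ContinuousOn (fun z : EuclideanSpace ℝ (Fin N) × EuclideanSpace ℝ (Fin N) =>
      fderiv ℝ (fderiv ℝ U) z.1 z.2 (B z.1 z.2)) (K ×ˢ Metric.sphere 0 1) :=
    ((hUc.comp continuousOn_fst hmaps).clm_apply continuousOn_snd).clm_apply
      ((hB.comp continuousOn_fst hmaps).clm_apply continuousOn_snd)
  obtain ⟨c, hc, hle⟩ := (hK.prod (isCompact_sphere _ _)).exists_forall_le' hcont (a := 0)
    (fun z hz => hUF.2.2.2 z.1 (hK𝒰 hz.1) z.2 (by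
      have := hz.2
      rintro h0
      simp [h0] at this))
  refine ⟨c, hc, fun u hu h => ?_⟩
  rcases eq_or_ne h 0 with rfl | hne
  · simp
  · have hn : ‖h‖ ≠ 0 := norm_ne_zero_iff.2 hne
    have h1 := hle (u, ‖h‖⁻¹ • h) ⟨hu, by simp [norm_smul, hn]⟩
    simp only [map_smul, smul_apply, smul_eq_mul] at h1
    calc c * ‖h‖ ^ 2 ≤ ‖h‖⁻¹ * (‖h‖⁻¹ * fderiv ℝ (fderiv ℝ U) u h (B u h)) * ‖h‖ ^ 2 := by
          gcongr
      _ = _ := by field_simp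

/-- With a `B`-convex entropy, the profiles from `u` to a nearby limit state stay near `u`. -/
theorem IsBConvexEntropyPair.eventually_profile_mem_ball (h𝒰 : IsOpen 𝒰)
    (hf : ContDiffOn ℝ 1 f 𝒰) (hB : ContinuousOn B 𝒰) (hUF : IsBConvexEntropyPair 𝒰 f B U F)
    {u : EuclideanSpace ℝ (Fin N)} (hu : u ∈ 𝒰) (hinj : Function.Injective (fderiv ℝ f u))
    {ρ : ℝ} (hρ : 0 < ρ) :
    ∀ᶠ w in 𝓝 u, ∀ v v' : ℝ → EuclideanSpace ℝ (Fin N),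
      (∀ y, 0 ≤ y → HasDerivWithinAt v (v' y) (Ici 0) y) → (∀ y, 0 ≤ y → v y ∈ 𝒰) →
      (∀ y, 0 ≤ y → B (v y) (v' y) = f (v y) - f w) → v 0 = u → Tendsto v atTop (𝓝 w) →
      ∀ y, 0 ≤ y → v y ∈ Metric.ball u ρ := by
  obtain ⟨k, hk, r₁, hr₁, hexp⟩ :=
    ((hf.contDiffAt (h𝒰.mem_nhds hu)).hasStrictFDerivAt one_ne_zero).exists_le_norm_image_sub hinj
  obtain ⟨r₂, hr₂, hball₂⟩ := Metric.nhds_basis_closedBall.mem_iff.1 (h𝒰.mem_nhds hu)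
  set r := min ρ (min r₁ r₂) with hr
  have hrpos : 0 < r := by positivity
  have hK : IsCompact (Metric.closedBall u r) := isCompact_closedBall u r
  have hK𝒰 : Metric.closedBall u r ⊆ 𝒰 :=
    (Metric.closedBall_subset_closedBall ((min_le_right _ _).trans (min_le_right _ _))).trans hball₂
  obtain ⟨c, hc, hcoer⟩ := hUF.exists_coercive h𝒰 hB hK hK𝒰
  obtain ⟨C₀, hC₀⟩ := hK.exists_bound_of_continuousOn (hB.mono hK𝒰)
  set C := max C₀ 1 with hC
  have hCpos : 0 < C := by positivity
  have hBle : ∀ x ∈ Metric.closedBall u r, ‖B x‖ ≤ C := fun x hx =>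
    (hC₀ x hx).trans (le_max_left _ _)
  -- In the ball the dissipation is at least `c ‖v'‖²`, and `k ‖v - w‖ ≤ ‖f v - f w‖ ≤ C ‖v'‖`. This
  -- `κ` is what lets the dissipation absorb the derivative of `κ ‖v - w‖²`.
  set κ := c * k / (2 * C) with hκ
  have hκpos : 0 < κ := by positivity
  have hsmall : ∀ᶠ w in 𝓝 u, entropyExcess f U F w u + κ * ‖u - w‖ ^ 2 < κ * (r / 2) ^ 2 := by
    have h1 : ContinuousAt (fun w => entropyExcess f U F w u + κ * ‖u - w‖ ^ 2) u := by
      refine ContinuousAt.add ?_ (by fun_prop)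
      exact ContinuousAt.comp (f := fun w => (w, u))
        (hUF.continuousAt_entropyExcess h𝒰 hf (z := (u, u)) hu hu) (by fun_prop)
    refine h1.eventually_lt_const ?_
    simp only [entropyExcess, sub_self, map_zero, norm_zero]
    norm_num
    positivity
  filter_upwards [hsmall, Metric.ball_mem_nhds u (half_pos hrpos), h𝒰.mem_nhds hu]
    with w hw hwr hw𝒰 v v' hder hv𝒰 hode hv0 hlim
  have hcont : ContinuousOn v (Ici 0) := fun y hy => (hder y hy).continuousWithinAt
  have hder₂ : ∀ y, 0 ≤ y → HasDerivWithinAt (fun y => entropyExcess f U F w (v y))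
      (-fderiv ℝ (fderiv ℝ U) (v y) (v' y) (B (v y) (v' y))) (Ici 0) y := fun y hy =>
    hUF.hasDerivWithinAt_entropyExcess h𝒰 hf (hder y hy) (hv𝒰 y hy) (hode y hy)
  have hanti : AntitoneOn (fun y => entropyExcess f U F w (v y)) (Ici 0) :=
    antitoneOn_of_hasDerivWithinAt_nonpos (convex_Ici 0)
      (fun y hy => (hder₂ y hy).continuousWithinAt)
      (fun y hy => (hder₂ y (interior_subset hy)).mono interior_subset)
      (fun y hy => neg_nonpos.2 (hUF.dissipation_nonneg (hv𝒰 y (interior_subset hy)) _))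
  have hexlim : Tendsto (fun y => entropyExcess f U F w (v y)) atTop (𝓝 0) := by
    have h1 : ContinuousAt (fun x => entropyExcess f U F w x) w :=
      ContinuousAt.comp (f := fun x => (w, x))
        (hUF.continuousAt_entropyExcess h𝒰 hf (z := (w, w)) hw𝒰 hw𝒰) (by fun_prop)
    have h2 := h1.tendsto.comp hlim
    simpa [entropyExcess, Function.comp_def] using h2
  -- The excess is nonincreasing along the whole profile, even outside the ball, and tends to `0`;
  -- this uses the entropy on all of `𝒰`.
  have hexnonneg : ∀ y, 0 ≤ y → 0 ≤ entropyExcess f U F w (v y) := by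
    intro y hy
    refine le_of_tendsto hexlim ?_
    filter_upwards [eventually_ge_atTop y] with t ht
    exact hanti hy (hy.trans ht) ht
  have hstay : ∀ y, 0 ≤ y → v y ∈ Metric.ball u r := by
    by_contra! hexit
    obtain ⟨y₀, hy₀, hy₀r⟩ := hexit
    set A := Ici (0 : ℝ) ∩ v ⁻¹' (Metric.ball u r)ᶜ with hA
    have hAclosed : IsClosed A :=
      hcont.preimage_isClosed_of_isClosed isClosed_Ici Metric.isOpen_ball.isClosed_compl
    have hAne : A.Nonempty := ⟨y₀, hy₀, hy₀r⟩
    have hAbdd : BddBelow A := ⟨0, fun y hy => hy.1⟩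
    -- The first exit time. Up to `T` the excess plus `κ ‖v - w‖²` does not increase; its small
    -- initial value keeps `v T` within `r / 2` of `w`, contradicting the exit.
    set T := sInf A with hT
    obtain ⟨hT0, hTr⟩ : T ∈ A := hAclosed.csInf_mem hAne hAbdd
    have hbefore : ∀ y, 0 ≤ y → y < T → v y ∈ Metric.ball u r := by
      intro y hy hyT
      by_contra h
      exact absurd (csInf_le hAbdd (show y ∈ A from ⟨hy, h⟩)) (not_le.2 hyT)
    have hderH : ∀ y, 0 ≤ y → HasDerivWithinAt
        (fun y => entropyExcess f U F w (v y) + κ * ‖v y - w‖ ^ 2)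
        (-fderiv ℝ (fderiv ℝ U) (v y) (v' y) (B (v y) (v' y)) +
          κ * (2 * inner ℝ (v y - w) (v' y))) (Ici 0) y := fun y hy =>
      (hder₂ y hy).add ((((hder y hy).sub_const w).norm_sq).const_mul κ)
    have hH : AntitoneOn (fun y => entropyExcess f U F w (v y) + κ * ‖v y - w‖ ^ 2)
        (Icc 0 T) := by
      refine antitoneOn_of_hasDerivWithinAt_nonpos (convex_Icc 0 T)
        (fun y hy => (hderH y hy.1).continuousWithinAt.mono Icc_subset_Ici_self)
        (fun y hy => (hderH y (interior_subset hy).1).mono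
          (interior_subset.trans Icc_subset_Ici_self)) (fun y hy => ?_)
      rw [interior_Icc] at hy
      have hyb := hbefore y hy.1.le hy.2
      have hyc := Metric.ball_subset_closedBall hyb
      have h1 := hcoer _ hyc (v' y)
      have hsub : Metric.ball u r ⊆ Metric.ball u r₁ :=
        Metric.ball_subset_ball ((min_le_right _ _).trans (min_le_left _ _))
      have h2 : k * ‖v y - w‖ ≤ C * ‖v' y‖ := by
        refine (hexp _ (hsub hyb) w (hsub
          (Metric.ball_subset_ball (half_le_self hrpos.le) hwr))).trans ?_
        rw [← hode y hy.1.le]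
        exact (B (v y)).le_of_opNorm_le (hBle _ hyc) _
      have h3 : inner ℝ (v y - w) (v' y) ≤ ‖v y - w‖ * ‖v' y‖ := real_inner_le_norm _ _
      have h4 : κ * (2 * inner ℝ (v y - w) (v' y)) ≤ c * ‖v' y‖ ^ 2 := by
        calc κ * (2 * inner ℝ (v y - w) (v' y)) ≤ κ * (2 * (‖v y - w‖ * ‖v' y‖)) := by gcongr
          _ = c / C * (k * ‖v y - w‖) * ‖v' y‖ := by rw [hκ]; field_simp
          _ ≤ c / C * (C * ‖v' y‖) * ‖v' y‖ := by gcongr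
          _ = _ := by field_simp
      linarith
    have h1 := hH (left_mem_Icc.2 hT0) (right_mem_Icc.2 hT0) hT0
    simp only [hv0] at h1
    have h2 := hexnonneg T hT0
    have h3 : ‖v T - w‖ ^ 2 < (r / 2) ^ 2 := by
      have : κ * ‖v T - w‖ ^ 2 < κ * (r / 2) ^ 2 := by linarith
      exact lt_of_mul_lt_mul_left this hκpos.le
    have h4 : ‖v T - w‖ < r / 2 := lt_of_pow_lt_pow_left₀ 2 (by positivity) h3
    refine hTr ?_
    rw [Metric.mem_ball]
    rw [Metric.mem_ball] at hwr
    calc dist (v T) u ≤ dist (v T) w + dist w u := dist_triangle _ _ _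
      _ < r / 2 + r / 2 := by rw [dist_eq_norm (v T) w]; exact add_lt_add h4 hwr
      _ = r := by ring
  exact fun y hy => Metric.ball_subset_ball (min_le_left _ _) (hstay y hy)

end EntropyConfinement

/-! ### Translation between layer solutions and profiles. -/

section Assembly

/-- Solutions of a smooth autonomous equation on the half line are smooth. -/
theorem contDiffOn_Ici_of_hasDerivWithinAt {E : Type*} [NormedAddCommGroup E] [NormedSpace ℝ E]
    {O : Set E} {G : E → E} (hG : ContDiffOn ℝ ∞ G O) {v : ℝ → E} (hv : ∀ y, 0 ≤ y → v y ∈ O)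
    (hder : ∀ y, 0 ≤ y → HasDerivWithinAt v (G (v y)) (Ici 0) y) :
    ContDiffOn ℝ ∞ v (Ici 0) := by
  rw [contDiffOn_infty]
  intro n
  induction n with
  | zero =>
    exact contDiffOn_zero.2 fun y hy => (hder y hy).continuousWithinAt
  | succ n ih =>
    push_cast
    rw [contDiffOn_succ_iff_derivWithin (uniqueDiffOn_Ici 0)]
    refine ⟨fun y hy => (hder y hy).differentiableWithinAt, by simp, ?_⟩
    refine ((hG.of_le (by exact_mod_cast le_top)).comp ih fun y hy => hv y hy).congr fun y hy => ?_
    exact (hder y hy).derivWithin (uniqueDiffOn_Ici 0 y hy)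

/-- Where `B` is invertible, the layer equation is an equation `v' = Q(v, w) (v - w)`. -/
theorem exists_profileOperator {E : Type*} [NormedAddCommGroup E] [NormedSpace ℝ E]
    [FiniteDimensional ℝ E] {𝒰 : Set E} (h𝒰 : IsOpen 𝒰) {f : E → E} (hf : ContDiffOn ℝ ∞ f 𝒰)
    {B : E → E →L[ℝ] E} (hB : ContDiffOn ℝ ∞ B 𝒰) {u : E} (hu : u ∈ 𝒰) (hBu : IsUnit (B u)) :
    ∃ Q : E × E → (E →L[ℝ] E), ContDiff ℝ 1 Q ∧
      Q (u, u) = Ring.inverse (B u) * fderiv ℝ f u ∧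
      ∃ ρ > 0, Metric.ball u ρ ⊆ 𝒰 ∧ (∀ v ∈ Metric.ball u ρ, IsUnit (B v)) ∧
        ∀ v ∈ Metric.ball u ρ, ∀ w ∈ Metric.ball u ρ,
          Q (v, w) (v - w) = Ring.inverse (B v) (f v - f w) := by
  have : CompleteSpace E := FiniteDimensional.complete ℝ E
  have : ProperSpace E := FiniteDimensional.proper_real E
  have hn := h𝒰.mem_nhds hu
  have hfu : ContDiffAt ℝ (2 : ℕ) f u := (contDiffOn_infty.1 hf 2).contDiffAt hn
  have hBat : ContDiffAt ℝ (1 : ℕ) B u := (contDiffOn_infty.1 hB 1).contDiffAt hn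
  have hinv : ContDiffAt ℝ (1 : ℕ) (fun v => Ring.inverse (B v)) u := by
    obtain ⟨e, he⟩ := hBu
    have h1 : ContDiffAt ℝ (1 : ℕ) (Ring.inverse : (E →L[ℝ] E) → _) (B u) :=
      he ▸ contDiffAt_ringInverse ℝ e
    exact h1.comp u hBat
  -- The superposition operators require globally defined maps, so `f` and `B⁻¹` are replaced by
  -- global extensions of their germs. Two derivatives of `f` are kept because the factorization
  -- loses one.
  obtain ⟨g, hg, hgf⟩ := exists_contDiff_eventuallyEq hfu
  obtain ⟨R, hR, hRB⟩ := exists_contDiff_eventuallyEq hinv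
  obtain ⟨q, hq, hqsub, hqu⟩ := exists_contDiff_factor (f := g) hg
  have hunit : ∀ᶠ v in 𝓝 u, IsUnit (B v) :=
    hBat.continuousAt.eventually (Units.isOpen.mem_nhds hBu)
  obtain ⟨ρ, hρ, hball⟩ := Metric.eventually_nhds_iff_ball.1
    (((h𝒰.eventually_mem hu).and hunit).and (hgf.and hRB))
  refine ⟨fun z => R z.1 * q z, ?_, ?_, ρ, hρ, fun v hv => (hball v hv).1.1,
    fun v hv => (hball v hv).1.2, fun v hv w hw => ?_⟩
  · exact ContDiff.mul ((show ContDiff ℝ 1 R from hR).comp contDiff_fst) hq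
  · simp only
    rw [hqu, hRB.self_of_nhds, hgf.fderiv_eq]
  · simp only
    rw [mul_apply_eq_comp, hqsub, (hball v hv).2.1, (hball w hw).2.1,
      (hball v hv).2.2]

variable {N : ℕ} {f : EuclideanSpace ℝ (Fin N) → EuclideanSpace ℝ (Fin N)}
  {B : EuclideanSpace ℝ (Fin N) → EuclideanSpace ℝ (Fin N) →L[ℝ] EuclideanSpace ℝ (Fin N)}

theorem self_mem_viscousLayerSet {𝒰 : Set (EuclideanSpace ℝ (Fin N))}
    {u : EuclideanSpace ℝ (Fin N)} (hu : u ∈ 𝒰) : u ∈ viscousLayerSet 𝒰 f B u :=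
  ⟨hu, fun _ => u, contDiffOn_const, fun _ _ => hu, fun y _ => by simp, rfl, tendsto_const_nhds⟩

theorem ringInverse_apply_eq_iff {E : Type*} [NormedAddCommGroup E] [NormedSpace ℝ E]
    {L : E →L[ℝ] E} (hL : IsUnit L) (x y : E) : Ring.inverse L y = x ↔ L x = y := by
  have h1 : ∀ x, L (Ring.inverse L x) = x := fun x => by
    rw [← mul_apply_eq_comp, Ring.mul_inverse_cancel L hL]; rfl
  have h2 : ∀ x, Ring.inverse L (L x) = x := fun x => by
    rw [← mul_apply_eq_comp, Ring.inverse_mul_cancel L hL]; rfl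
  exact ⟨fun h => by rw [← h, h1], fun h => by rw [← h, h2]⟩

/-- Smoothness of the profile cannot be read off from `Q`, which is only `C¹`. It comes from the
autonomous form `v' = B(v)⁻¹ (f(v) - f(w))` for fixed `w`, whose right side is smooth in the ball.
-/
theorem IsProfile.mem_viscousLayerSet {𝒰 𝒱 : Set (EuclideanSpace ℝ (Fin N))}
    (h𝒰 : IsOpen 𝒰) (hf : ContDiffOn ℝ ∞ f 𝒰) (hB : ContDiffOn ℝ ∞ B 𝒰)
    {Q : EuclideanSpace ℝ (Fin N) × EuclideanSpace ℝ (Fin N) →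
      (EuclideanSpace ℝ (Fin N) →L[ℝ] EuclideanSpace ℝ (Fin N))}
    {u w : EuclideanSpace ℝ (Fin N)} {ρ : ℝ} (hρ : Metric.ball u ρ ⊆ 𝒰)
    (hBρ : ∀ v ∈ Metric.ball u ρ, IsUnit (B v))
    (hQ : ∀ v ∈ Metric.ball u ρ, ∀ w ∈ Metric.ball u ρ,
      Q (v, w) (v - w) = Ring.inverse (B v) (f v - f w))
    {v : ℝ → EuclideanSpace ℝ (Fin N)} (hv : IsProfile Q u w v)
    (hvρ : ∀ y, 0 ≤ y → v y ∈ Metric.ball u ρ) (hwρ : w ∈ Metric.ball u ρ)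
    (hv𝒱 : ∀ y, 0 ≤ y → v y ∈ 𝒱) (hw𝒱 : w ∈ 𝒱) :
    w ∈ viscousLayerSet 𝒱 f B u := by
  have hder : ∀ y, 0 ≤ y →
      HasDerivWithinAt v (Ring.inverse (B (v y)) (f (v y) - f w)) (Ici 0) y := by
    intro y hy
    rw [← hQ _ (hvρ y hy) _ hwρ]
    exact hv.hasDerivWithinAt y hy
  have hG : ContDiffOn ℝ ∞ (fun x => Ring.inverse (B x) (f x - f w)) (Metric.ball u ρ) := by
    intro x hx
    have hn := h𝒰.mem_nhds (hρ hx)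
    obtain ⟨e, he⟩ := hBρ x hx
    have h1 : ContDiffAt ℝ ∞ (Ring.inverse : (EuclideanSpace ℝ (Fin N) →L[ℝ]
        EuclideanSpace ℝ (Fin N)) → _) (B x) := he ▸ contDiffAt_ringInverse ℝ e
    exact ((h1.comp x (hB.contDiffAt hn)).clm_apply
      ((hf.contDiffAt hn).sub contDiffAt_const)).contDiffWithinAt
  refine ⟨hw𝒱, v, contDiffOn_Ici_of_hasDerivWithinAt hG hvρ hder, hv𝒱, fun y hy => ?_,
    hv.initial, hv.tendsto⟩
  rw [(hder y hy).derivWithin (uniqueDiffOn_Ici 0 y hy)]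
  exact (ringInverse_apply_eq_iff (hBρ _ (hvρ y hy)) _ _).1 rfl

theorem isProfile_of_layer
    {Q : EuclideanSpace ℝ (Fin N) × EuclideanSpace ℝ (Fin N) →
      (EuclideanSpace ℝ (Fin N) →L[ℝ] EuclideanSpace ℝ (Fin N))}
    {u w : EuclideanSpace ℝ (Fin N)} {ρ : ℝ}
    (hBρ : ∀ v ∈ Metric.ball u ρ, IsUnit (B v))
    (hQ : ∀ v ∈ Metric.ball u ρ, ∀ w ∈ Metric.ball u ρ,
      Q (v, w) (v - w) = Ring.inverse (B v) (f v - f w))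
    {v : ℝ → EuclideanSpace ℝ (Fin N)} (hv : ContDiffOn ℝ ∞ v (Ici 0))
    (hode : ∀ y, 0 ≤ y → B (v y) (derivWithin v (Ici 0) y) = f (v y) - f w)
    (h0 : v 0 = u) (hlim : Tendsto v atTop (𝓝 w))
    (hvρ : ∀ y, 0 ≤ y → v y ∈ Metric.ball u ρ) (hwρ : w ∈ Metric.ball u ρ) :
    IsProfile Q u w v where
  hasDerivWithinAt y hy := by
    rw [hQ _ (hvρ y hy) _ hwρ,
      (ringInverse_apply_eq_iff (hBρ _ (hvρ y hy)) _ _).2 (hode y hy)]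
    exact (hv.differentiableOn (by simp) y hy).hasDerivWithinAt
  initial := h0
  tendsto := hlim

theorem exists_pos_le_abs {ι : Type*} [Finite ι] (μ : ι → ℝ) :
    ∃ m > 0, ∀ j, μ j ≠ 0 → m ≤ |μ j| := by
  have h : ∀ᶠ m in 𝓝[>] (0 : ℝ), ∀ j, μ j ≠ 0 → m ≤ |μ j| := by
    refine eventually_all.2 fun j => ?_
    by_cases hj : μ j = 0
    · simp [hj]
    · filter_upwards [nhdsWithin_le_nhds (Iio_mem_nhds (abs_pos.2 hj))] with m hm _
      exact (mem_Iio.1 hm).le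
  obtain ⟨m, hm, hm0⟩ := (h.and self_mem_nhdsWithin).exists
  exact ⟨m, hm0, hm⟩

theorem finrank_span_basis_lt {E : Type*} [AddCommGroup E] [Module ℝ E]
    (b : Module.Basis (Fin N) ℝ E) {p : ℕ} (hp : p ≤ N) :
    Module.finrank ℝ (Submodule.span ℝ (b '' {j | (j : ℕ) < p})) = p := by
  have hli : LinearIndependent ℝ (fun i : Fin p => b (Fin.castLE hp i)) :=
    b.linearIndependent.comp _ (Fin.castLE_injective hp)
  have hrange : b '' {j | (j : ℕ) < p} = range (fun i : Fin p => b (Fin.castLE hp i)) := by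
    ext x
    constructor
    · rintro ⟨j, hj, rfl⟩
      exact ⟨⟨j, hj⟩, rfl⟩
    · rintro ⟨i, rfl⟩
      exact ⟨Fin.castLE hp i, i.2, rfl⟩
  rw [hrange, finrank_span_eq_card hli, Fintype.card_fin]

end Assembly

theorem theorem3p4 {N : ℕ} (p : ℕ) (hp : p ≤ N)
    (𝒰 : Set (EuclideanSpace ℝ (Fin N))) (h𝒰 : IsOpen 𝒰)
    (f : EuclideanSpace ℝ (Fin N) → EuclideanSpace ℝ (Fin N)) (hf : ContDiffOn ℝ ∞ f 𝒰)
    (B : EuclideanSpace ℝ (Fin N) → EuclideanSpace ℝ (Fin N) →L[ℝ] EuclideanSpace ℝ (Fin N))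
    (hB : ContDiffOn ℝ ∞ B 𝒰)
    -- strict hyperbolicity: real distinct eigenvalues `lam 0 < lam 1 < ⋯` of `∇f`, eigenvectors `r j`
    (lam : Fin N → EuclideanSpace ℝ (Fin N) → ℝ)
    (r : Fin N → EuclideanSpace ℝ (Fin N) → EuclideanSpace ℝ (Fin N))
    (hlam : ∀ u ∈ 𝒰, StrictMono fun j => lam j u)
    (hr0 : ∀ u ∈ 𝒰, ∀ j, r j u ≠ 0)
    (hr : ∀ u ∈ 𝒰, ∀ j, fderiv ℝ f u (r j u) = lam j u • r j u)
    (uB : EuclideanSpace ℝ (Fin N)) (huB : uB ∈ 𝒰)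
    -- near `uB` the `r j` are eigenvectors of `B` with positive eigenvalues
    (hBr : ∀ᶠ u in 𝓝 uB, ∀ j, ∃ b : ℝ, 0 < b ∧ B u (r j u) = b • r j u)
    -- near `uB` the first `p` eigenvalues are negative and the others nonnegative
    (hneg : ∀ᶠ u in 𝓝 uB, ∀ j : Fin N, (j : ℕ) < p → lam j u < 0)
    (hnonneg : ∀ᶠ u in 𝓝 uB, ∀ j : Fin N, p ≤ (j : ℕ) → 0 ≤ lam j u) :
    uB ∈ viscousLayerSet 𝒰 f B uB ∧
    (∃ M ⊆ viscousLayerSet 𝒰 f B uB, uB ∈ M ∧ IsC1Submanifold p M) ∧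
    ((∀ j : Fin N, p ≤ (j : ℕ) → 0 < lam j uB) →
      -- the layer set itself, if some entropy pair on the state domain is `B`-convex
      ((∃ U F : EuclideanSpace ℝ (Fin N) → ℝ, IsBConvexEntropyPair 𝒰 f B U F) →
        IsLocallySubmanifoldAt p (viscousLayerSet 𝒰 f B uB) uB
          (Submodule.span ℝ {w | ∃ j : Fin N, (j : ℕ) < p ∧ w = r j uB})) ∧
      -- without entropies: the layer set of every small enough state domain around `uB`
      (∃ 𝒰₀ : Set (EuclideanSpace ℝ (Fin N)), IsOpen 𝒰₀ ∧ uB ∈ 𝒰₀ ∧ 𝒰₀ ⊆ 𝒰 ∧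
        ∀ 𝒱 : Set (EuclideanSpace ℝ (Fin N)), IsOpen 𝒱 → uB ∈ 𝒱 → 𝒱 ⊆ 𝒰₀ →
          IsLocallySubmanifoldAt p (viscousLayerSet 𝒱 f B uB) uB
            (Submodule.span ℝ {w | ∃ j : Fin N, (j : ℕ) < p ∧ w = r j uB}))) := by
  -- the eigenbasis at `uB`
  have hli : LinearIndependent ℝ (fun j => r j uB) :=
    Module.End.eigenvectors_linearIndependent' (fderiv ℝ f uB).toLinearMap (fun j => lam j uB)
      (hlam uB huB).injective _ fun j =>
        ⟨Module.End.mem_eigenspace_iff.2 (hr uB huB j), hr0 uB huB j⟩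
  let b : Module.Basis (Fin N) ℝ (EuclideanSpace ℝ (Fin N)) :=
    basisOfLinearIndependentOfCardEqFinrank' _ hli (by simp)
  have hb : ∀ j, b j = r j uB := fun j => by
    simp [b]
  choose β hβ hBβ using hBr.self_of_nhds
  have hfb : ∀ j, fderiv ℝ f uB (b j) = lam j uB • b j := fun j => by
    rw [hb]; exact hr uB huB j
  have hBb : ∀ j, B uB (b j) = β j • b j := fun j => by rw [hb]; exact hBβ j
  have hBu : IsUnit (B uB) := by
    let Binv : EuclideanSpace ℝ (Fin N) →L[ℝ] EuclideanSpace ℝ (Fin N) :=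
      LinearMap.toContinuousLinearMap (b.constr ℝ fun j => (β j)⁻¹ • b j)
    have hBinv : ∀ j, Binv (b j) = (β j)⁻¹ • b j := fun j => by simp [Binv]
    refine ⟨⟨B uB, Binv, ContinuousLinearMap.coe_injective (b.ext fun j => ?_),
      ContinuousLinearMap.coe_injective (b.ext fun j => ?_)⟩, rfl⟩
    · change B uB (Binv (b j)) = b j
      rw [hBinv, map_smul, hBb, smul_smul, inv_mul_cancel₀ (hβ j).ne', one_smul]
    · change Binv (B uB (b j)) = b j
      rw [hBb, map_smul, hBinv, smul_smul, mul_inv_cancel₀ (hβ j).ne', one_smul]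
  have hBi : ∀ j, Ring.inverse (B uB) (b j) = (β j)⁻¹ • b j := fun j => by
    rw [ringInverse_apply_eq_iff hBu, map_smul, hBb, smul_smul,
      inv_mul_cancel₀ (hβ j).ne', one_smul]
  -- The eigenvalues of `B⁻¹ ∇f` at `uB`.
  set μ : Fin N → ℝ := fun j => lam j uB * (β j)⁻¹ with hμ
  have hμneg : ∀ j, μ j < 0 ↔ (j : ℕ) < p := by
    intro j
    refine ⟨fun h => ?_, fun h =>
      mul_neg_of_neg_of_pos (hneg.self_of_nhds j h) (inv_pos.2 (hβ j))⟩
    by_contra hj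
    exact absurd h (not_lt.2 (mul_nonneg (hnonneg.self_of_nhds j (not_lt.1 hj))
      (inv_pos.2 (hβ j)).le))
  obtain ⟨m, hm, hmμ⟩ := exists_pos_le_abs μ
  obtain ⟨Q, hQ, hQu, ρ, hρ, hρ𝒰, hBρ, hQρ⟩ := exists_profileOperator h𝒰 hf hB huB hBu
  have hQb : ∀ j, Q (uB, uB) (b j) = μ j • b j := fun j => by
    rw [hQu, mul_apply_eq_comp, hfb, map_smul, hBi, smul_smul]
  obtain ⟨θ, hθ, hθ', hθ0, hθlayer, hθunique⟩ := exists_straightening b hm (fun j => by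
    rcases lt_or_ge (μ j) 0 with h | h
    · left
      have := hmμ j h.ne
      rw [abs_of_neg h] at this
      linarith
    · exact Or.inr h) hQ hQb
  have hset : {j | μ j < 0} = {j : Fin N | (j : ℕ) < p} := by ext j; exact hμneg j
  rw [hset] at hθlayer hθunique
  have hspan : {w | ∃ j : Fin N, (j : ℕ) < p ∧ w = r j uB} = b '' {j | (j : ℕ) < p} := by
    ext w
    simp only [mem_ofPred_eq, mem_image, hb]
    exact exists_congr fun j => and_congr_right fun _ => eq_comm
  rw [hspan]
  set L := Submodule.span ℝ (b '' {j | (j : ℕ) < p}) with hL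
  have hLp : Module.finrank ℝ L = p := finrank_span_basis_lt b hp
  -- The constructed profiles stay in arbitrarily small balls as `w` approaches `uB`, hence in any
  -- prescribed domain.
  have hlayer : ∀ 𝒱 : Set (EuclideanSpace ℝ (Fin N)), IsOpen 𝒱 → uB ∈ 𝒱 →
      ∀ᶠ w in 𝓝 uB, θ w ∈ L → w ∈ viscousLayerSet 𝒱 f B uB := by
    intro 𝒱 h𝒱 hu𝒱
    obtain ⟨ε, hε, hε𝒱⟩ := Metric.isOpen_iff.1 h𝒱 uB hu𝒱
    filter_upwards [hθlayer (min ρ ε) (by positivity), Metric.ball_mem_nhds uB hρ,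
      h𝒱.mem_nhds hu𝒱] with w hw hwρ hw𝒱 hwL
    obtain ⟨v, hv, hvball⟩ := hw hwL
    exact hv.mem_viscousLayerSet h𝒰 hf hB hρ𝒰 hBρ hQρ
      (fun y hy => Metric.ball_subset_ball (min_le_left _ _) (hvball y hy)) hwρ
      (fun y hy => hε𝒱 (Metric.ball_subset_ball (min_le_right _ _) (hvball y hy))) hw𝒱
  refine ⟨self_mem_viscousLayerSet huB, ?_, fun hpos => ?_⟩
  -- Without hyperbolicity and confinement, other profiles are not excluded, so only the limit
  -- states with `θ w ∈ L` are kept.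
  · have hS : ∀ᶠ w in 𝓝 uB, w ∈ viscousLayerSet 𝒰 f B uB ∩ {w | θ w ∈ L} ↔ θ w ∈ L := by
      filter_upwards [hlayer 𝒰 h𝒰 huB] with w hw
      exact ⟨fun h => h.2, fun h => ⟨hw h, h⟩⟩
    obtain ⟨W, -, huW, huS, hsub, -⟩ :=
      isLocallySubmanifoldAt_of_straightening hLp hθ hθ' hθ0 hS
    exact ⟨viscousLayerSet 𝒰 f B uB ∩ {w | θ w ∈ L} ∩ W, fun w hw => hw.1.1, ⟨huS, huW⟩, hsub⟩
  have hμne : ∀ j, lam j uB ≠ 0 := fun j => by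
    rcases lt_or_ge (j : ℕ) p with h | h
    · exact (hneg.self_of_nhds j h).ne
    · exact (hpos j h).ne'
  obtain ⟨ρ', hρ', hunique⟩ := hθunique fun j =>
    hmμ j (mul_ne_zero (hμne j) (inv_ne_zero (hβ j).ne'))
  have hρmin : 0 < min ρ ρ' := lt_min hρ hρ'
  -- Both (a) and (b) reduce to confinement of the profiles to a fixed small ball. In (b) it is
  -- immediate, as `𝒱` lies in that ball.
  have hmain : ∀ 𝒱 : Set (EuclideanSpace ℝ (Fin N)), IsOpen 𝒱 → uB ∈ 𝒱 →
      (∀ᶠ w in 𝓝 uB, ∀ v : ℝ → EuclideanSpace ℝ (Fin N), ContDiffOn ℝ ∞ v (Ici 0) →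
        (∀ y, 0 ≤ y → v y ∈ 𝒱) →
        (∀ y, 0 ≤ y → B (v y) (derivWithin v (Ici 0) y) = f (v y) - f w) →
        v 0 = uB → Tendsto v atTop (𝓝 w) →
        ∀ y, 0 ≤ y → v y ∈ Metric.ball uB (min ρ ρ')) →
      IsLocallySubmanifoldAt p (viscousLayerSet 𝒱 f B uB) uB L := by
    intro 𝒱 h𝒱 hu𝒱 hconf
    refine isLocallySubmanifoldAt_of_straightening hLp hθ hθ' hθ0 ?_
    filter_upwards [hlayer 𝒱 h𝒱 hu𝒱, hconf, hunique, Metric.ball_mem_nhds uB hρ]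
      with w hw hwconf hwunique hwρ
    refine ⟨?_, hw⟩
    rintro ⟨-, v, hv, hv𝒱, hode, h0, hlim⟩
    have hvball := hwconf v hv hv𝒱 hode h0 hlim
    exact hwunique v (isProfile_of_layer hBρ hQρ hv hode h0 hlim
      (fun y hy => Metric.ball_subset_ball (min_le_left _ _) (hvball y hy)) hwρ)
      (fun y hy => Metric.ball_subset_ball (min_le_right _ _) (hvball y hy))
  refine ⟨?_, Metric.ball uB (min ρ ρ'), Metric.isOpen_ball, Metric.mem_ball_self hρmin,
    (Metric.ball_subset_ball (min_le_left _ _)).trans hρ𝒰, fun 𝒱 h𝒱 hu𝒱 h𝒱ρ =>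
      hmain 𝒱 h𝒱 hu𝒱 (Eventually.of_forall fun w v _ hv𝒱 _ _ _ y hy => h𝒱ρ (hv𝒱 y hy))⟩
  rintro ⟨U, F, hUF⟩
  have hinj : Function.Injective (fderiv ℝ f uB) := by
    refine (injective_iff_map_eq_zero _).2 fun x hx => ext_coordCLM b fun j => ?_
    have := coordCLM_diagonal hfb x j
    rw [hx, map_zero, eq_comm, mul_eq_zero] at this
    rw [map_zero]
    exact this.resolve_left (hμne j)
  refine hmain 𝒰 h𝒰 huB ?_
  filter_upwards [hUF.eventually_profile_mem_ball h𝒰 (hf.of_le (by exact_mod_cast le_top))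
    hB.continuousOn huB hinj hρmin] with w hw v hv hv𝒰 hode h0 hlim
  exact hw v (derivWithin v (Ici 0))
    (fun y hy => (hv.differentiableOn (by simp) y hy).hasDerivWithinAt) hv𝒰 hode h0 hlim
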